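/- Let $A\ge 2$, let $\Delta_{A-1}=\{x\in[0,1]^A:\sum_{i=1}^A x_i=1\}$, let $r\in[0,1]$, $\gamma\in\Delta_{A-1}$, $\alpha\in(0,\infty)^A$, $\beta\in\mathbb{R}$, and consider the homogeneous feedback functions $F_i(k)=\alpha_i k^\beta$. For $x\in(0,\infty)^A$ put $$p_i(x)=\frac{F_i(x_i)}{\sum_{j=1}^A F_j(x_j)},\qquad v^{(i)}=(1-r)e^{(i)}+r\gamma,\qquad G(x)=(1-r)\,p(x)+r\gamma-x,$$ where $e^{(i)}$ is the $i$-th unit vector. Fix $\chi(0)\in\Delta_{A-1}$. For a total initial wealth $N>0$ with $N\chi_i(0)\ge 1$ for all $i$, let $X^{(N)}=(X^{(N)}(n))_{n\in\mathbb{N}_0}$ be the Markov process in $[1,\infty)^A$ with $X^{(N)}(0)=N\chi(0)$ which, given its past up to time $n$, makes the step $X^{(N)}(n+1)=X^{(N)}(n)+v^{(i)}$ with probability $p_i(X^{(N)}(n))$, $i=1,\dots,A$ (probabilities of coinciding steps add up), and let $\chi^{(N)}(n)=X^{(N)}(n)/(N+n)\in\Delta_{A-1}$ be the process of wealth shares.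 Then the initial value problem $$\frac{d}{dt}Z(t)=\frac{G(Z(t))}{1+t}\quad(t\ge 0),\qquad Z(0)=\chi(0),$$ has exactly one solution $Z:[0,\infty)\to\Delta_{A-1}$, and for every sequence of real numbers $N_k\to\infty$ with $N_k\chi_i(0)\ge1$ for all $k$ and $i$, the processes $\bigl(\chi^{(N_k)}(\lfloor N_k t\rfloor)\bigr)_{t\ge 0}$ converge weakly, as $k\to\infty$, on the Skorokhod space $\mathbb{D}([0,\infty),\Delta_{A-1})$ to the deterministic path $Z$. -/

import Mathlib

open MeasureTheory ProbabilityTheory Filter Set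
open scoped Topology NNReal

/-- The Skorokhod space `D([0, ∞), E)` of càdlàg paths: right-continuous functions on `[0, ∞)` with
left limits in `E` at every point (at `0` the left neighbourhood filter is trivial). -/
@[ext]
structure SkorokhodSpace (E : Type*) [TopologicalSpace E] where
  toFun : ℝ≥0 → E
  rightCont : ∀ t, ContinuousWithinAt toFun (Ici t) t
  leftLim : ∀ t, ∃ l, Tendsto toFun (𝓝[<] t) (𝓝 l)

namespace SkorokhodSpace

instance instCoeFun {E : Type*} [TopologicalSpace E] :
    CoeFun (SkorokhodSpace E) (fun _ => ℝ≥0 → E) := ⟨toFun⟩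

/-- The basic J1-neighbourhood of a path `x`: all paths `y` that are `ε`-close to `x` on `[0, T]`
after a time change `τ` (an increasing bijection of `[0, ∞)`) that is itself `ε`-close to the
identity on `[0, T]`. -/
def basicNhd {E : Type*} [PseudoMetricSpace E] (x : SkorokhodSpace E) (T : ℝ≥0) (ε : ℝ) :
    Set (SkorokhodSpace E) :=
  {y | ∃ τ : ℝ≥0 ≃o ℝ≥0, ∀ t ≤ T, dist (τ t) t ≤ ε ∧ dist (y t) (x (τ t)) ≤ ε}

theorem basicNhd_anti {E : Type*} [PseudoMetricSpace E] (x : SkorokhodSpace E) {T T' : ℝ≥0}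
    {ε ε' : ℝ} (hT : T ≤ T') (hε : ε' ≤ ε) : basicNhd x T' ε' ⊆ basicNhd x T ε := by
  rintro y ⟨τ, h⟩
  exact ⟨τ, fun t ht => ⟨(h t (ht.trans hT)).1.trans hε, (h t (ht.trans hT)).2.trans hε⟩⟩

/-- The Skorokhod (J1) topology on `D([0, ∞), E)`: a set is open if with each of its points it
contains a basic J1-neighbourhood of that point. Thus `xₙ → x` if and only if for every `T` there
are increasing bijections `τₙ` of `[0, ∞)` with `sup_{t ≤ T} |τₙ t - t| → 0` and
`sup_{t ≤ T} dist (xₙ t) (x (τₙ t)) → 0`, the usual characterization of J1-convergence. -/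
instance instTopologicalSpace {E : Type*} [PseudoMetricSpace E] :
    TopologicalSpace (SkorokhodSpace E) where
  IsOpen s := ∀ x ∈ s, ∃ T : ℝ≥0, ∃ ε : ℝ, 0 < ε ∧ basicNhd x T ε ⊆ s
  isOpen_univ := fun _ _ => ⟨0, 1, one_pos, subset_univ _⟩
  isOpen_inter := by
    rintro s t hs ht x ⟨hxs, hxt⟩
    obtain ⟨T, ε, hε, h⟩ := hs x hxs
    obtain ⟨T', ε', hε', h'⟩ := ht x hxt
    refine ⟨max T T', min ε ε', lt_min hε hε', subset_inter ?_ ?_⟩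
    · exact (basicNhd_anti x (le_max_left _ _) (min_le_left _ _)).trans h
    · exact (basicNhd_anti x (le_max_right _ _) (min_le_right _ _)).trans h'
  isOpen_sUnion := by
    rintro S hS x ⟨s, hs, hxs⟩
    obtain ⟨T, ε, hε, h⟩ := hS s hs x hxs
    exact ⟨T, ε, hε, h.trans (subset_sUnion_of_mem hs)⟩

instance instMeasurableSpace {E : Type*} [PseudoMetricSpace E] :
    MeasurableSpace (SkorokhodSpace E) := borel _

instance instBorelSpace {E : Type*} [PseudoMetricSpace E] : BorelSpace (SkorokhodSpace E) := ⟨rfl⟩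

/-- The càdlàg step path `t ↦ c ⌊N t⌋` of a sequence `c`. -/
noncomputable def stepPath {E : Type*} [TopologicalSpace E] (N : ℝ) (c : ℕ → E) :
    SkorokhodSpace E where
  toFun t := c ⌊N * t⌋₊
  rightCont := by
    intro t
    apply tendsto_nhds_of_eventually_eq
    rcases le_or_gt N 0 with hN | hN
    · refine Eventually.of_forall fun s => ?_
      show c ⌊N * (s : ℝ)⌋₊ = c ⌊N * (t : ℝ)⌋₊
      rw [Nat.floor_of_nonpos (mul_nonpos_of_nonpos_of_nonneg hN s.coe_nonneg),
        Nat.floor_of_nonpos (mul_nonpos_of_nonpos_of_nonneg hN t.coe_nonneg)]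
    · have hc : ContinuousAt (fun s : ℝ≥0 => N * (s : ℝ)) t := by fun_prop
      have h1 : ∀ᶠ s : ℝ≥0 in 𝓝[≥] t, N * (s : ℝ) < ⌊N * (t : ℝ)⌋₊ + 1 :=
        (hc.eventually_lt_const (Nat.lt_floor_add_one _)).filter_mono nhdsWithin_le_nhds
      filter_upwards [h1, self_mem_nhdsWithin] with s hs hts
      have hts' : (t : ℝ) ≤ s := NNReal.coe_le_coe.2 hts
      have h0 : 0 ≤ N * (t : ℝ) := mul_nonneg hN.le t.coe_nonneg
      have h2 : N * (t : ℝ) ≤ N * s := mul_le_mul_of_nonneg_left hts' hN.le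
      congr 1
      rw [Nat.floor_eq_iff (h0.trans h2)]
      exact ⟨(Nat.floor_le h0).trans h2, hs⟩
  leftLim := by
    intro t
    rcases le_or_gt (N * (t : ℝ)) 0 with hN | hN
    · refine ⟨c 0, tendsto_nhds_of_eventually_eq ?_⟩
      rcases le_or_gt N 0 with hN' | hN'
      · refine Eventually.of_forall fun s => ?_
        rw [Nat.floor_of_nonpos (mul_nonpos_of_nonpos_of_nonneg hN' s.coe_nonneg)]
      · filter_upwards [self_mem_nhdsWithin] with s hs
        have hs' : (s : ℝ) ≤ t := NNReal.coe_le_coe.2 (le_of_lt hs)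
        rw [Nat.floor_of_nonpos ((mul_le_mul_of_nonneg_left hs' hN'.le).trans hN)]
    · have hN' : 0 < N := by
        by_contra h
        exact absurd hN (not_lt.2 (mul_nonpos_of_nonpos_of_nonneg (not_lt.1 h) t.coe_nonneg))
      refine ⟨c (⌈N * (t : ℝ)⌉₊ - 1), tendsto_nhds_of_eventually_eq ?_⟩
      have hpos : 0 < ⌈N * (t : ℝ)⌉₊ := Nat.ceil_pos.2 hN
      have hlt : ((⌈N * (t : ℝ)⌉₊ - 1 : ℕ) : ℝ) < N * t :=
        Nat.lt_ceil.1 (Nat.sub_lt hpos one_pos)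
      have hc : ContinuousAt (fun s : ℝ≥0 => N * (s : ℝ)) t := by fun_prop
      have h1 : ∀ᶠ s : ℝ≥0 in 𝓝[<] t, ((⌈N * (t : ℝ)⌉₊ - 1 : ℕ) : ℝ) < N * s :=
        (hc.eventually_const_lt hlt).filter_mono nhdsWithin_le_nhds
      filter_upwards [h1, self_mem_nhdsWithin] with s hs hst
      have hst' : (s : ℝ) < t := NNReal.coe_lt_coe.2 hst
      congr 1
      rw [Nat.floor_eq_iff (mul_nonneg hN'.le s.coe_nonneg)]
      refine ⟨hs.le, ?_⟩
      have h3 : ((⌈N * (t : ℝ)⌉₊ - 1 : ℕ) : ℝ) + 1 = ⌈N * (t : ℝ)⌉₊ := by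
        exact_mod_cast Nat.sub_add_cancel hpos
      rw [h3]
      exact (mul_lt_mul_of_pos_left hst' hN').trans_le (Nat.le_ceil _)

end SkorokhodSpace

namespace WealthModel

/-- The homogeneous feedback functions `F_i(k) = α_i k ^ β`. -/
noncomputable def feedback {A : ℕ} (α : Fin A → ℝ) (β : ℝ) (i : Fin A) (k : ℝ) : ℝ :=
  α i * k ^ β

/-- The probabilities `p_i(x) = F_i(x_i) / (F_1(x_1) + … + F_A(x_A))`. For homogeneous feedback
they depend only on the direction of `x` in the positive orthant, so they are the same for a wealth
vector and for the corresponding vector of shares. -/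
noncomputable def prob {A : ℕ} (α : Fin A → ℝ) (β : ℝ) (x : Fin A → ℝ) (i : Fin A) : ℝ :=
  feedback α β i (x i) / ∑ j, feedback α β j (x j)

/-- The increment `v^(i) = (1 - r) e^(i) + r γ`. -/
noncomputable def increment {A : ℕ} (r : ℝ) (γ : Fin A → ℝ) (i : Fin A) : Fin A → ℝ :=
  (1 - r) • Pi.single i 1 + r • γ

/-- The vector field `G(x) = (1 - r) p(x) + r γ - x`. -/
noncomputable def field {A : ℕ} (α : Fin A → ℝ) (β r : ℝ) (γ : Fin A → ℝ) (x : Fin A → ℝ) :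
    Fin A → ℝ :=
  (1 - r) • prob α β x + r • γ - x

/-- `X` is a version of the wealth process started from `x₀`: a Markov process whose one-step
transition kernel is `x ↦ ∑ i, p_i(x) δ_{x + v^(i)}`, that is, given the past up to time `n`, the
process jumps from `X n` to `X n + v^(i)` with probability `p_i (X n)`. -/
structure IsWealthProcess {A : ℕ} (α : Fin A → ℝ) (β r : ℝ) (γ x₀ : Fin A → ℝ)
    {Ω : Type*} [MeasurableSpace Ω] (P : Measure Ω) (X : ℕ → Ω → Fin A → ℝ) : Prop where
  measurable : ∀ n, Measurable (X n)
  initial : ∀ᵐ ω ∂P, X 0 ω = x₀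
  transition : ∀ (n : ℕ) (B : Set (Fin A → ℝ)), MeasurableSet B →
    P[(X (n + 1) ⁻¹' B).indicator (fun _ => (1 : ℝ)) |
        Filtration.natural X (fun m => (measurable m).stronglyMeasurable) n]
      =ᵐ[P] fun ω => ∑ i, prob α β (X n ω) i *
        B.indicator (fun _ => (1 : ℝ)) (X n ω + increment r γ i)

open Classical in
/-- The shares `χ(n) = X(n) / (N + n)` as a point of the simplex. Almost surely the quotient lies in
the simplex; on the exceptional null event, where it does not, the value is set to `χ₀`. -/
noncomputable def share {A : ℕ} (χ₀ : stdSimplex ℝ (Fin A)) (N : ℝ) {Ω : Type*}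
    (X : ℕ → Ω → Fin A → ℝ) (n : ℕ) (ω : Ω) : stdSimplex ℝ (Fin A) :=
  if h : (N + n)⁻¹ • X n ω ∈ stdSimplex ℝ (Fin A) then ⟨(N + n)⁻¹ • X n ω, h⟩ else χ₀

/-- The rescaled process `t ↦ χ(⌊N t⌋)` as a random element of `D([0, ∞), Δ_{A-1})`. -/
noncomputable def rescaledShare {A : ℕ} (χ₀ : stdSimplex ℝ (Fin A)) (N : ℝ) {Ω : Type*}
    (X : ℕ → Ω → Fin A → ℝ) (ω : Ω) : SkorokhodSpace (stdSimplex ℝ (Fin A)) :=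
  SkorokhodSpace.stepPath N (fun n => share χ₀ N X n ω)

/-- `Z : [0, ∞) → Δ_{A-1}` solves `dZ/dt = G(Z) / (1 + t)`, `Z(0) = χ₀` (the derivative at `0` is
one-sided). -/
def IsSolution {A : ℕ} (α : Fin A → ℝ) (β r : ℝ) (γ : Fin A → ℝ) (χ₀ : stdSimplex ℝ (Fin A))
    (Z : ℝ≥0 → stdSimplex ℝ (Fin A)) : Prop :=
  Z 0 = χ₀ ∧ ∀ t : ℝ≥0,
    HasDerivWithinAt (fun s : ℝ => (Z s.toNNReal : Fin A → ℝ))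
      ((1 + (t : ℝ))⁻¹ • field α β r γ (Z t)) (Ici 0) t

end WealthModel

/-! Homogeneous feedback makes `drift` invariant under positive scaling, so `Y t = (1 + t) • Z t`
turns the share equation into the autonomous equation `Y' = drift Y`. Its right-hand side has
nonnegative coordinates, hence `Y` never falls below its starting point. This keeps it away from the
boundary of the orthant, where `prob` may be singular; on `{y | ∀ i, c ≤ y i}` with `c > 0` the
drift is Lipschitz (`norm_drift_sub_le`). Existence and uniqueness follow (`exists_isFlow`,
`IsFlow.eqOn`) and transfer to `Z` (`IsFlow.isSolution`, `IsSolution.isFlow`).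

The rescaled wealth `X n / N` is a noisy Euler scheme of step `1 / N` for the same equation, and it
too stays above its starting point. The mean square error against `Y (n / N)` satisfies `e (n + 1) ≤
(1 + C / N) * e n + C / N ^ 2`, so by Gronwall it is `O(1 / N)` for `n ≤ N * T`
(`IsWealthProcess.integral_sum_sq_le`).

No maximal inequality or tightness argument is needed. Shares move by at most `1 / N` per step and
`Z` is 1-Lipschitz, so closeness on a fixed finite grid forces closeness on all of `[0, T]`
(`dist_floor_le_of_dist_grid_le`). Chebyshev and a union bound give locally uniform convergence in
probability, which implies weak convergence because the limit is deterministic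
(`tendstoInDistribution_of_tendsto_measure`). -/

/-- A bounded globally Lipschitz autonomous vector field has a solution on `[0, ∞)` from every
starting point. -/
theorem exists_hasDerivWithinAt_Ici_of_lipschitzWith {E : Type*} [NormedAddCommGroup E]
    [NormedSpace ℝ E] [CompleteSpace E] {f : E → E} {K L : ℝ≥0} (hf : LipschitzWith K f)
    (hL : ∀ x, ‖f x‖ ≤ L) (x₀ : E) :
    ∃ Y : ℝ → E, Y 0 = x₀ ∧ ∀ t, 0 ≤ t → HasDerivWithinAt Y (f (Y t)) (Ici 0) t := by
  have key : ∀ n : ℕ, ∃ Y : ℝ → E, Y 0 = x₀ ∧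
      ∀ t ∈ Icc (0 : ℝ) n, HasDerivWithinAt Y (f (Y t)) (Icc 0 n) t := by
    intro n
    -- Speed at most `L` confines the solution to the ball of radius `L * n` up to time `n`, so
    -- Picard–Lindelöf covers the whole interval at once.
    have hpl : IsPicardLindelof (fun _ => f) (⟨0, by simp⟩ : Icc (0 : ℝ) n) x₀ (L * n) 0 L K := by
      refine ⟨fun t _ => hf.lipschitzOnWith, fun x _ => continuousOn_const, fun t _ x _ => hL x, ?_⟩
      simp
    exact hpl.exists_eq_forall_mem_Icc_hasDerivWithinAt₀
  choose Y hY0 hY using key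
  have hright : ∀ n : ℕ, ∀ t ∈ Ico (0 : ℝ) n, HasDerivWithinAt (Y n) (f (Y n t)) (Ici t) t :=
    fun n t ht => (hY n t (Ico_subset_Icc_self ht)).mono_of_mem_nhdsWithin
      (Icc_mem_nhdsGE_of_mem ht)
  have hcont : ∀ n : ℕ, ContinuousOn (Y n) (Icc 0 n) := fun n t ht => (hY n t ht).continuousWithinAt
  have agree : ∀ m n : ℕ, m ≤ n → EqOn (Y m) (Y n) (Icc 0 m) := by
    intro m n hmn
    have hc : (m : ℝ) ≤ n := by exact_mod_cast hmn
    refine ODE_solution_unique_of_mem_Icc_right (v := fun _ => f) (s := fun _ => univ) (K := K)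
      (fun t _ => hf.lipschitzOnWith) (hcont m) (hright m) (fun _ _ => mem_univ _)
      ((hcont n).mono (Icc_subset_Icc_right hc))
      (fun t ht => hright n t ⟨ht.1, ht.2.trans_le hc⟩) (fun _ _ => mem_univ _) ?_
    rw [hY0, hY0]
  -- The `+ 1` puts `t` strictly before the right end of its interval, so the derivative within `Icc
  -- 0 n` is also one within `Ici 0`.
  refine ⟨fun t => Y (⌈t⌉₊ + 1) t, hY0 _, fun t ht => ?_⟩
  set n := ⌈t⌉₊ + 1 with hn
  have htn : t < n := by
    have := Nat.le_ceil t
    push_cast [hn]; linarith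
  have h1 : HasDerivWithinAt (Y n) (f (Y n t)) (Ici 0) t :=
    (hY n t ⟨ht, htn.le⟩).mono_of_mem_nhdsWithin
      (by
        rw [← Ici_inter_Iic]
        exact inter_mem self_mem_nhdsWithin (mem_nhdsWithin_of_mem_nhds (Iic_mem_nhds htn)))
  refine h1.congr_of_eventuallyEq ?_ rfl
  filter_upwards [self_mem_nhdsWithin, mem_nhdsWithin_of_mem_nhds (Iio_mem_nhds htn)] with s hs hsn
  have hs0 : (0 : ℝ) ≤ s := hs
  have hsn' : s < n := hsn
  -- A point `s` near `t` may select a different local solution; both selections are compared with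
  -- `Y (n + 1)`.
  have hle : ⌈s⌉₊ + 1 ≤ n + 1 := by
    have := Nat.ceil_le.2 hsn'.le
    omega
  have hmem : s ∈ Icc (0 : ℝ) (⌈s⌉₊ + 1 : ℕ) := ⟨hs0, by
    have := Nat.le_ceil s
    push_cast; linarith⟩
  exact (agree _ _ hle hmem).trans (agree n (n + 1) (Nat.le_succ n) ⟨hs0, hsn'.le⟩).symm

/-! ### Jump probabilities and drift: scaling and Lipschitz bounds. -/

namespace WealthModel

variable {A : ℕ} {α : Fin A → ℝ} {β r : ℝ} {γ : Fin A → ℝ}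

theorem feedback_nonneg (hα : ∀ i, 0 < α i) (i : Fin A) {k : ℝ} (hk : 0 ≤ k) :
    0 ≤ feedback α β i k :=
  mul_nonneg (hα i).le (Real.rpow_nonneg hk _)

theorem feedback_pos (hα : ∀ i, 0 < α i) (i : Fin A) {k : ℝ} (hk : 0 < k) :
    0 < feedback α β i k :=
  mul_pos (hα i) (Real.rpow_pos_of_pos hk _)

theorem sum_feedback_pos [NeZero A] (hα : ∀ i, 0 < α i) {x : Fin A → ℝ} (hx : ∀ i, 0 < x i) :
    0 < ∑ j, feedback α β j (x j) :=
  Finset.sum_pos (fun i _ => feedback_pos hα i (hx i)) Finset.univ_nonempty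

theorem prob_nonneg (hα : ∀ i, 0 < α i) {x : Fin A → ℝ} (hx : ∀ i, 0 ≤ x i) (i : Fin A) :
    0 ≤ prob α β x i :=
  div_nonneg (feedback_nonneg hα i (hx i))
    (Finset.sum_nonneg fun j _ => feedback_nonneg hα j (hx j))

theorem sum_prob [NeZero A] (hα : ∀ i, 0 < α i) {x : Fin A → ℝ} (hx : ∀ i, 0 < x i) :
    ∑ i, prob α β x i = 1 := by
  simp only [prob]
  rw [← Finset.sum_div, div_self (sum_feedback_pos hα hx).ne']

theorem prob_le_one [NeZero A] (hα : ∀ i, 0 < α i) {x : Fin A → ℝ} (hx : ∀ i, 0 < x i)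
    (i : Fin A) : prob α β x i ≤ 1 := by
  rw [← sum_prob (β := β) hα hx]
  exact Finset.single_le_sum (fun j _ => prob_nonneg hα (fun i => (hx i).le) j) (Finset.mem_univ i)

theorem prob_smul {c : ℝ} (hc : 0 < c) {x : Fin A → ℝ} (hx : ∀ i, 0 ≤ x i) :
    prob α β (c • x) = prob α β x := by
  funext i
  have h : ∀ j, feedback α β j ((c • x) j) = c ^ β * feedback α β j (x j) := by
    intro j
    simp only [feedback, Pi.smul_apply, smul_eq_mul, Real.mul_rpow hc.le (hx j)]
    ring
  simp only [prob, h]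
  rw [← Finset.mul_sum, mul_div_mul_left _ _ (Real.rpow_pos_of_pos hc β).ne']

/-- Above `c` the logarithm is `1 / c`-Lipschitz, so every feedback value changes by a factor within
`exp (± η)`, where `η = |β| * ‖x - y‖ / c`. Numerator and denominator together cost a factor `exp (2
* η)`, and the bound to reach is `4 * η`. -/
theorem prob_sub_prob_le [NeZero A] (hα : ∀ i, 0 < α i) {c : ℝ} (hc : 0 < c) {x y : Fin A → ℝ}
    (hx : ∀ i, c ≤ x i) (hy : ∀ i, c ≤ y i) (i : Fin A) :
    prob α β x i - prob α β y i ≤ 4 * |β| / c * ‖x - y‖ := by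
  have log_sub : ∀ {a b : ℝ}, c ≤ a → c ≤ b → Real.log a - Real.log b ≤ |a - b| / c := by
    intro a b ha hb
    have ha' := hc.trans_le ha
    have hb' := hc.trans_le hb
    rw [← Real.log_div ha'.ne' hb'.ne']
    calc Real.log (a / b) ≤ a / b - 1 := Real.log_le_sub_one_of_pos (div_pos ha' hb')
      _ = (a - b) / b := by field_simp
      _ ≤ |a - b| / b := by gcongr; exact le_abs_self _
      _ ≤ |a - b| / c := by gcongr
  set η := |β| * (‖x - y‖ / c) with hη
  have hη0 : 0 ≤ η := by positivity
  have hlog : ∀ j, |β * (Real.log (x j) - Real.log (y j))| ≤ η := by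
    intro j
    have hj : |x j - y j| ≤ ‖x - y‖ := norm_le_pi_norm (x - y) j
    rw [abs_mul, hη]
    gcongr
    rw [abs_le']
    have h1 := log_sub (hx j) (hy j)
    have h2 := log_sub (hy j) (hx j)
    rw [abs_sub_comm] at h2
    have h3 : |x j - y j| / c ≤ ‖x - y‖ / c := by gcongr
    constructor <;> linarith
  have hx0 : ∀ j, 0 < x j := fun j => hc.trans_le (hx j)
  have hy0 : ∀ j, 0 < y j := fun j => hc.trans_le (hy j)
  have hfb : ∀ (z : Fin A → ℝ) (j), 0 < z j →
      feedback α β j (z j) = α j * Real.exp (β * Real.log (z j)) := by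
    intro z j hz
    rw [feedback, Real.rpow_def_of_pos hz, mul_comm β]
  have hup : ∀ j, feedback α β j (x j) ≤ Real.exp η * feedback α β j (y j) := by
    intro j
    rw [hfb x j (hx0 j), hfb y j (hy0 j), mul_left_comm, ← Real.exp_add]
    have := (abs_le.1 (hlog j)).2
    have h0 := (hα j).le
    gcongr
    linarith
  have hdown : ∀ j, feedback α β j (y j) ≤ Real.exp η * feedback α β j (x j) := by
    intro j
    rw [hfb x j (hx0 j), hfb y j (hy0 j), mul_left_comm, ← Real.exp_add]
    have := (abs_le.1 (hlog j)).1
    have h0 := (hα j).le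
    gcongr
    linarith
  have hle : prob α β x i ≤ Real.exp (2 * η) * prob α β y i := by
    have hsx := sum_feedback_pos (β := β) hα hx0
    have hsy := sum_feedback_pos (β := β) hα hy0
    have hs : ∑ j, feedback α β j (y j) ≤ Real.exp η * ∑ j, feedback α β j (x j) := by
      rw [Finset.mul_sum]
      exact Finset.sum_le_sum fun j _ => hdown j
    rw [prob, prob, ← mul_div_assoc, div_le_div_iff₀ hsx hsy]
    calc _ ≤ (Real.exp η * feedback α β i (y i)) * (Real.exp η * ∑ j, feedback α β j (x j)) :=
          mul_le_mul (hup i) hs hsy.le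
            (mul_nonneg (Real.exp_nonneg _) (feedback_pos hα i (hy0 i)).le)
      _ = _ := by rw [two_mul, Real.exp_add]; ring
  have h4 : 4 * |β| / c * ‖x - y‖ = 4 * η := by rw [hη]; ring
  have hp0 := prob_nonneg (β := β) hα (fun j => (hy0 j).le) i
  rw [h4]
  -- For `2 * η ≤ 1`, `exp (2 * η) - 1 ≤ 4 * η`; otherwise `4 * η ≥ 2` exceeds any difference of
  -- probabilities.
  rcases le_total (2 * η) 1 with h | h
  · have h5 := Real.abs_exp_sub_one_le (x := 2 * η) (by rwa [abs_of_nonneg (by positivity)])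
    rw [abs_of_nonneg (a := 2 * η) (by positivity)] at h5
    have h6 := (le_abs_self _).trans h5
    have hp1 := prob_le_one (β := β) hα hy0 i
    nlinarith
  · have := prob_le_one (β := β) hα hx0 i
    linarith

theorem norm_prob_sub_le [NeZero A] (hα : ∀ i, 0 < α i) {c : ℝ} (hc : 0 < c) {x y : Fin A → ℝ}
    (hx : ∀ i, c ≤ x i) (hy : ∀ i, c ≤ y i) :
    ‖prob α β x - prob α β y‖ ≤ 4 * |β| / c * ‖x - y‖ := by
  refine (pi_norm_le_iff_of_nonneg (by positivity)).2 fun i => ?_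
  have h1 := prob_sub_prob_le (β := β) hα hc hx hy i
  have h2 := prob_sub_prob_le (β := β) hα hc hy hx i
  rw [norm_sub_rev] at h2
  rw [Pi.sub_apply, Real.norm_eq_abs, abs_le']
  constructor <;> linarith

/-- The mean increment `(1 - r) p(x) + r γ` of the wealth process at `x`. -/
noncomputable def drift (α : Fin A → ℝ) (β r : ℝ) (γ x : Fin A → ℝ) : Fin A → ℝ :=
  (1 - r) • prob α β x + r • γ

theorem field_eq_drift_sub (x : Fin A → ℝ) : field α β r γ x = drift α β r γ x - x := rfl

theorem drift_smul {c : ℝ} (hc : 0 < c) {x : Fin A → ℝ} (hx : ∀ i, 0 ≤ x i) :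
    drift α β r γ (c • x) = drift α β r γ x := by
  rw [drift, drift, prob_smul hc hx]

theorem drift_mem_stdSimplex [NeZero A] (hα : ∀ i, 0 < α i) (hr : r ∈ Icc (0 : ℝ) 1)
    (hγ : γ ∈ stdSimplex ℝ (Fin A)) {x : Fin A → ℝ} (hx : ∀ i, 0 < x i) :
    drift α β r γ x ∈ stdSimplex ℝ (Fin A) :=
  convex_stdSimplex ℝ (Fin A)
    ⟨fun i => prob_nonneg hα (fun j => (hx j).le) i, sum_prob hα hx⟩ hγ
    (sub_nonneg.2 hr.2) hr.1 (by ring)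

theorem drift_nonneg (hα : ∀ i, 0 < α i) (hr : r ∈ Icc (0 : ℝ) 1)
    (hγ : γ ∈ stdSimplex ℝ (Fin A)) {x : Fin A → ℝ} (hx : ∀ i, 0 ≤ x i) (i : Fin A) :
    0 ≤ drift α β r γ x i :=
  add_nonneg (mul_nonneg (sub_nonneg.2 hr.2) (prob_nonneg hα hx i)) (mul_nonneg hr.1 (hγ.1 i))

theorem norm_drift_sub_le [NeZero A] (hα : ∀ i, 0 < α i) (hr : r ∈ Icc (0 : ℝ) 1) {c : ℝ}
    (hc : 0 < c) {x y : Fin A → ℝ} (hx : ∀ i, c ≤ x i) (hy : ∀ i, c ≤ y i) :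
    ‖drift α β r γ x - drift α β r γ y‖ ≤ 4 * |β| / c * ‖x - y‖ := by
  have h : drift α β r γ x - drift α β r γ y = (1 - r) • (prob α β x - prob α β y) := by
    simp only [drift, smul_sub]; abel
  rw [h, norm_smul, Real.norm_of_nonneg (sub_nonneg.2 hr.2)]
  exact (mul_le_of_le_one_left (norm_nonneg _) (by linarith [hr.1])).trans
    (norm_prob_sub_le hα hc hx hy)

theorem _root_.norm_le_one_of_mem_stdSimplex {ι : Type*} [Fintype ι] {x : ι → ℝ}
    (hx : x ∈ stdSimplex ℝ ι) : ‖x‖ ≤ 1 :=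
  (pi_norm_le_iff_of_nonneg zero_le_one).2 fun i => by
    have := mem_Icc_of_mem_stdSimplex hx i
    rw [Real.norm_of_nonneg this.1]
    exact this.2

theorem _root_.norm_sub_le_one_of_mem_stdSimplex {ι : Type*} [Fintype ι] {x y : ι → ℝ}
    (hx : x ∈ stdSimplex ℝ ι) (hy : y ∈ stdSimplex ℝ ι) : ‖x - y‖ ≤ 1 :=
  (pi_norm_le_iff_of_nonneg zero_le_one).2 fun i => by
    have h1 := mem_Icc_of_mem_stdSimplex hx i
    have h2 := mem_Icc_of_mem_stdSimplex hy i
    rw [Pi.sub_apply, Real.norm_eq_abs, abs_le]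
    constructor <;> linarith [h1.1, h1.2, h2.1, h2.2]

/-- If `Y` has a coordinatewise nonnegative derivative on `[0, ∞)`, then `Y 0 ≤ Y t`. -/
theorem _root_.le_of_hasDerivWithinAt_nonneg {ι : Type*} [Fintype ι] {Y Y' : ℝ → ι → ℝ}
    (hY : ∀ t, 0 ≤ t → HasDerivWithinAt Y (Y' t) (Ici 0) t) (h0 : ∀ t, 0 ≤ t → ∀ i, 0 ≤ Y' t i)
    {t : ℝ} (ht : 0 ≤ t) (i : ι) : Y 0 i ≤ Y t i := by
  have hi : ∀ s, 0 ≤ s → HasDerivWithinAt (fun s => Y s i) (Y' s i) (Ici 0) s :=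
    fun s hs => hasDerivWithinAt_pi.1 (hY s hs) i
  refine monotoneOn_of_deriv_nonneg (convex_Ici (0 : ℝ))
    (fun s hs => (hi s hs).continuousWithinAt) (fun s hs => ?_) (fun s hs => ?_) self_mem_Ici ht ht
  · rw [interior_Ici] at hs ⊢
    exact ((hi s (le_of_lt hs)).mono Ioi_subset_Ici_self).differentiableWithinAt
  · rw [interior_Ici] at hs
    rw [((hi s (le_of_lt hs)).hasDerivAt (Ici_mem_nhds hs)).deriv]
    exact h0 s (le_of_lt hs) i

end WealthModel

/-! ### The unnormalised flow and its equivalence with the share equation. -/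

namespace WealthModel

variable {A : ℕ} {α : Fin A → ℝ} {β r : ℝ} {γ χ : Fin A → ℝ}

/-- `Y` solves `dY/dt = (1 - r) p(Y) + r γ` on `[0, ∞)` with `Y 0 = χ`, and stays above `χ`. -/
structure IsFlow (α : Fin A → ℝ) (β r : ℝ) (γ χ : Fin A → ℝ) (Y : ℝ → Fin A → ℝ) : Prop where
  zero : Y 0 = χ
  hasDeriv : ∀ t, 0 ≤ t → HasDerivWithinAt Y (drift α β r γ (Y t)) (Ici 0) t
  le : ∀ t, 0 ≤ t → ∀ i, χ i ≤ Y t i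

theorem exists_pos_le [NeZero A] (hχ : ∀ i, 0 < χ i) : ∃ c > 0, ∀ i, c ≤ χ i := by
  obtain ⟨i, hi⟩ := Finite.exists_min χ
  exact ⟨χ i, hχ i, hi⟩

/-- The drift is only locally well behaved, so its argument is first truncated from below at `χ`,
which makes the field globally Lipschitz. The truncated solution is coordinatewise nondecreasing,
hence stays above `χ`, and the truncation never acts. -/
theorem exists_isFlow [NeZero A] (hα : ∀ i, 0 < α i) (hr : r ∈ Icc (0 : ℝ) 1)
    (hγ : γ ∈ stdSimplex ℝ (Fin A)) (hχ : ∀ i, 0 < χ i) : ∃ Y, IsFlow α β r γ χ Y := by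
  obtain ⟨c, hc, hcχ⟩ := exists_pos_le hχ
  set g : (Fin A → ℝ) → Fin A → ℝ := fun y i => max (y i) (χ i) with hg
  have hgχ : ∀ y i, χ i ≤ g y i := fun y i => le_max_right _ _
  have hgpos : ∀ y i, 0 < g y i := fun y i => (hχ i).trans_le (hgχ y i)
  have hgl : ∀ x y, ‖g x - g y‖ ≤ ‖x - y‖ := fun x y =>
    (pi_norm_le_iff_of_nonneg (norm_nonneg _)).2 fun i =>
      (abs_max_sub_max_le_abs _ _ _).trans (norm_le_pi_norm (x - y) i)
  have hlip : LipschitzWith (4 * |β| / c).toNNReal (fun y => drift α β r γ (g y)) := by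
    refine LipschitzWith.of_dist_le_mul fun x y => ?_
    rw [dist_eq_norm, dist_eq_norm, Real.coe_toNNReal _ (by positivity)]
    refine (norm_drift_sub_le hα hr hc (fun i => (hcχ i).trans (hgχ x i))
      (fun i => (hcχ i).trans (hgχ y i))).trans ?_
    gcongr
    exact hgl x y
  obtain ⟨Y, hY0, hY⟩ := exists_hasDerivWithinAt_Ici_of_lipschitzWith hlip (L := 1)
    (fun x => norm_le_one_of_mem_stdSimplex (drift_mem_stdSimplex hα hr hγ (hgpos x))) χ
  have hle : ∀ t, 0 ≤ t → ∀ i, χ i ≤ Y t i := fun t ht i => by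
    have := le_of_hasDerivWithinAt_nonneg hY
      (fun t _ => drift_nonneg hα hr hγ (fun i => (hgpos (Y t) i).le)) ht i
    rwa [hY0] at this
  refine ⟨Y, hY0, fun t ht => ?_, hle⟩
  have : g (Y t) = Y t := funext fun i => max_eq_left (hle t ht i)
  simpa only [this] using hY t ht

namespace IsFlow

variable {Y Y' : ℝ → Fin A → ℝ}

theorem pos (h : IsFlow α β r γ χ Y) (hχ : ∀ i, 0 < χ i) {t : ℝ} (ht : 0 ≤ t) (i : Fin A) :
    0 < Y t i :=
  (hχ i).trans_le (h.le t ht i)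

theorem eqOn [NeZero A] (h : IsFlow α β r γ χ Y) (h' : IsFlow α β r γ χ Y')
    (hα : ∀ i, 0 < α i) (hr : r ∈ Icc (0 : ℝ) 1) (hχ : ∀ i, 0 < χ i) {t : ℝ} (ht : 0 ≤ t) :
    Y t = Y' t := by
  obtain ⟨c, hc, hcχ⟩ := exists_pos_le hχ
  have hlip : LipschitzOnWith (4 * |β| / c).toNNReal (drift α β r γ) {y | ∀ i, c ≤ y i} := by
    refine LipschitzOnWith.of_dist_le_mul fun x hx y hy => ?_
    rw [dist_eq_norm, dist_eq_norm, Real.coe_toNNReal _ (by positivity)]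
    exact norm_drift_sub_le hα hr hc hx hy
  refine ODE_solution_unique_of_mem_Icc_right (v := fun _ => drift α β r γ)
    (s := fun _ => {y | ∀ i, c ≤ y i}) (fun t _ => hlip)
    (fun s hs => (h.hasDeriv s hs.1).continuousWithinAt.mono Icc_subset_Ici_self)
    (fun s hs => (h.hasDeriv s hs.1).mono (Ici_subset_Ici.2 hs.1))
    (fun s hs i => (hcχ i).trans (h.le s hs.1 i))
    (fun s hs => (h'.hasDeriv s hs.1).continuousWithinAt.mono Icc_subset_Ici_self)
    (fun s hs => (h'.hasDeriv s hs.1).mono (Ici_subset_Ici.2 hs.1))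
    (fun s hs i => (hcχ i).trans (h'.le s hs.1 i)) (h.zero.trans h'.zero.symm)
    (right_mem_Icc.2 ht)

theorem sum_eq [NeZero A] (h : IsFlow α β r γ χ Y) (hα : ∀ i, 0 < α i)
    (hr : r ∈ Icc (0 : ℝ) 1) (hγ : γ ∈ stdSimplex ℝ (Fin A)) (hχ : ∀ i, 0 < χ i)
    (hχ1 : ∑ i, χ i = 1) {t : ℝ} (ht : 0 ≤ t) : ∑ i, Y t i = 1 + t := by
  have hd : ∀ s ∈ Ici (0 : ℝ), HasDerivWithinAt (fun s => ∑ i, Y s i - s) 0 (Ici 0) s := by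
    intro s hs
    have h1 := HasDerivWithinAt.fun_sum (u := Finset.univ)
      fun i _ => hasDerivWithinAt_pi.1 (h.hasDeriv s hs) i
    rw [(drift_mem_stdSimplex hα hr hγ (fun i => h.pos hχ hs i)).2] at h1
    simpa using h1.fun_sub (hasDerivWithinAt_id s _)
  have := (convex_Ici (0 : ℝ)).norm_image_sub_le_of_norm_hasDerivWithin_le hd
    (C := 0) (fun s _ => by simp) self_mem_Ici ht
  rw [zero_mul, norm_le_zero_iff] at this
  simp only [h.zero, hχ1] at this
  linarith

theorem norm_add_sub_le [NeZero A] (h : IsFlow α β r γ χ Y) (hα : ∀ i, 0 < α i)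
    (hr : r ∈ Icc (0 : ℝ) 1) (hγ : γ ∈ stdSimplex ℝ (Fin A)) (hχ : ∀ i, 0 < χ i) {t s : ℝ}
    (ht : 0 ≤ t) (hs : 0 ≤ s) : ‖Y (t + s) - Y t‖ ≤ s := by
  have := (convex_Ici (0 : ℝ)).norm_image_sub_le_of_norm_hasDerivWithin_le (C := 1)
    (fun s hs => h.hasDeriv s hs)
    (fun s hs => norm_le_one_of_mem_stdSimplex
      (drift_mem_stdSimplex hα hr hγ (fun i => h.pos hχ hs i))) ht (add_nonneg ht hs)
  simpa [abs_of_nonneg hs] using this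

/-- This is the local error of the Euler scheme: over time `s` the flow moves by at most `s`, so its
velocity varies by at most the Lipschitz constant times `s`. -/
theorem norm_add_sub_sub_le [NeZero A] (h : IsFlow α β r γ χ Y) (hα : ∀ i, 0 < α i)
    (hr : r ∈ Icc (0 : ℝ) 1) (hγ : γ ∈ stdSimplex ℝ (Fin A)) {c : ℝ} (hc : 0 < c)
    (hcχ : ∀ i, c ≤ χ i) {t s : ℝ} (ht : 0 ≤ t) (hs : 0 ≤ s) :
    ‖Y (t + s) - Y t - s • drift α β r γ (Y t)‖ ≤ 4 * |β| / c * s ^ 2 := by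
  have hχ : ∀ i, 0 < χ i := fun i => hc.trans_le (hcχ i)
  have hd : ∀ u ∈ Icc t (t + s), HasDerivWithinAt (fun u => Y u - u • drift α β r γ (Y t))
      (drift α β r γ (Y u) - drift α β r γ (Y t)) (Icc t (t + s)) u := by
    intro u hu
    have h1 := (h.hasDeriv u (ht.trans hu.1)).mono
      (Icc_subset_Ici_self.trans (Ici_subset_Ici.2 ht) : Icc t (t + s) ⊆ Ici 0)
    simpa using h1.fun_sub ((hasDerivWithinAt_id u _).smul_const (drift α β r γ (Y t)))
  have hb : ∀ u ∈ Icc t (t + s),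
      ‖drift α β r γ (Y u) - drift α β r γ (Y t)‖ ≤ 4 * |β| / c * s := by
    intro u hu
    refine (norm_drift_sub_le hα hr hc (fun i => (hcχ i).trans (h.le u (ht.trans hu.1) i))
      (fun i => (hcχ i).trans (h.le t ht i))).trans ?_
    have h2 := h.norm_add_sub_le hα hr hγ hχ ht (sub_nonneg.2 hu.1)
    rw [add_sub_cancel] at h2
    gcongr
    linarith [hu.2]
  have := (convex_Icc t (t + s)).norm_image_sub_le_of_norm_hasDerivWithin_le hd hb
    (left_mem_Icc.2 (by linarith)) (right_mem_Icc.2 (by linarith))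
  rw [add_sub_cancel_left, Real.norm_of_nonneg hs] at this
  have e : Y (t + s) - (t + s) • drift α β r γ (Y t) - (Y t - t • drift α β r γ (Y t))
      = Y (t + s) - Y t - s • drift α β r γ (Y t) := by
    rw [add_smul]; abel
  rw [e] at this
  exact this.trans_eq (by ring)

theorem inv_smul_mem_stdSimplex [NeZero A] (h : IsFlow α β r γ χ Y) (hα : ∀ i, 0 < α i)
    (hr : r ∈ Icc (0 : ℝ) 1) (hγ : γ ∈ stdSimplex ℝ (Fin A)) (hχ : ∀ i, 0 < χ i)
    (hχ1 : ∑ i, χ i = 1) {t : ℝ} (ht : 0 ≤ t) : (1 + t)⁻¹ • Y t ∈ stdSimplex ℝ (Fin A) := by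
  refine ⟨fun i => mul_nonneg (by positivity) (h.pos hχ ht i).le, ?_⟩
  simp only [Pi.smul_apply, smul_eq_mul]
  rw [← Finset.mul_sum, h.sum_eq hα hr hγ hχ hχ1 ht, inv_mul_cancel₀ (by positivity)]

end IsFlow

theorem IsFlow.isSolution {χ₀ : stdSimplex ℝ (Fin A)} {Y : ℝ → Fin A → ℝ}
    (h : IsFlow α β r γ χ₀ Y) (hχ : ∀ i, 0 < (χ₀ : Fin A → ℝ) i)
    {Z : ℝ≥0 → stdSimplex ℝ (Fin A)} (hZ : ∀ t, (Z t : Fin A → ℝ) = (1 + (t : ℝ))⁻¹ • Y t) :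
    IsSolution α β r γ χ₀ Z := by
  refine ⟨DFunLike.coe_injective (by simp [hZ, h.zero]), fun t => ?_⟩
  have ht : (0 : ℝ) < 1 + t := by positivity
  have h1 : HasDerivWithinAt (fun s : ℝ => (1 + s)⁻¹) (-1 / (1 + (t : ℝ)) ^ 2) (Ici 0) t :=
    (((hasDerivAt_id (t : ℝ)).const_add 1).fun_inv ht.ne').hasDerivWithinAt
  have h2 := h1.smul (h.hasDeriv t t.2)
  refine (h2.congr_of_mem (fun s hs => ?_) t.2).congr_deriv ?_
  · simp [hZ, Real.coe_toNNReal s hs]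
  · rw [field_eq_drift_sub, hZ, drift_smul (x := Y t) (inv_pos.2 ht) (fun i => (h.pos hχ t.2 i).le)]
    ext i
    simp only [Pi.add_apply, Pi.smul_apply, Pi.sub_apply, smul_eq_mul]
    field_simp
    ring

/-- A solution in the simplex is only known to be nonnegative beforehand, but that suffices for a
nonnegative drift. Staying above `χ₀`, and thus in the Lipschitz region when `χ₀` is positive, is a
consequence, so uniqueness covers every simplex-valued solution. -/
theorem IsSolution.isFlow [NeZero A] {χ₀ : stdSimplex ℝ (Fin A)}
    {W : ℝ≥0 → stdSimplex ℝ (Fin A)} (h : IsSolution α β r γ χ₀ W) (hα : ∀ i, 0 < α i)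
    (hr : r ∈ Icc (0 : ℝ) 1) (hγ : γ ∈ stdSimplex ℝ (Fin A)) :
    IsFlow α β r γ χ₀ (fun t => (1 + t) • (W t.toNNReal : Fin A → ℝ)) := by
  have hd : ∀ t : ℝ, 0 ≤ t → HasDerivWithinAt (fun t : ℝ => (1 + t) • (W t.toNNReal : Fin A → ℝ))
      (drift α β r γ ((1 + t) • (W t.toNNReal : Fin A → ℝ))) (Ici 0) t := by
    intro t ht
    have ht' : (0 : ℝ) < 1 + t := by positivity
    have h1 := h.2 t.toNNReal
    rw [Real.coe_toNNReal t ht] at h1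
    have h2 := ((hasDerivAt_id t).const_add 1).hasDerivWithinAt.smul h1
    refine h2.congr_deriv ?_
    rw [drift_smul (x := ⇑(W t.toNNReal)) ht' (fun i => (W t.toNNReal).2.1 i), field_eq_drift_sub]
    ext i
    simp only [Pi.add_apply, Pi.smul_apply, Pi.sub_apply, smul_eq_mul, id]
    field_simp
    ring
  have h0 : (1 + (0 : ℝ)) • (W (0 : ℝ).toNNReal : Fin A → ℝ) = χ₀ := by simp [h.1]
  refine ⟨h0, hd, fun t ht i => ?_⟩
  have := le_of_hasDerivWithinAt_nonneg hd (fun t ht => drift_nonneg hα hr hγ fun i =>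
    mul_nonneg (by positivity) ((W t.toNNReal).2.1 i)) ht i
  rwa [h0] at this

/-- The field is a difference of two points of the simplex, so its sup norm is at most one, and the
factor `1 / (1 + t)` only helps. -/
theorem IsSolution.dist_le [NeZero A] {χ₀ : stdSimplex ℝ (Fin A)}
    {W : ℝ≥0 → stdSimplex ℝ (Fin A)} (h : IsSolution α β r γ χ₀ W) (hα : ∀ i, 0 < α i)
    (hr : r ∈ Icc (0 : ℝ) 1) (hγ : γ ∈ stdSimplex ℝ (Fin A))
    (hχ : ∀ i, 0 < (χ₀ : Fin A → ℝ) i) (s t : ℝ≥0) : dist (W s) (W t) ≤ dist s t := by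
  have hb : ∀ u ∈ Ici (0 : ℝ),
      ‖(1 + (u.toNNReal : ℝ))⁻¹ • field α β r γ (W u.toNNReal)‖ ≤ 1 := by
    intro u hu
    have hpos : ∀ i, 0 < (W u.toNNReal : Fin A → ℝ) i := fun i =>
      pos_of_mul_pos_right ((h.isFlow hα hr hγ).pos hχ hu i) (add_nonneg zero_le_one hu)
    rw [norm_smul, norm_inv, Real.norm_of_nonneg (by positivity)]
    refine mul_le_one₀ (inv_le_one_of_one_le₀ (by simp)) (norm_nonneg _) ?_
    exact norm_sub_le_one_of_mem_stdSimplex (drift_mem_stdSimplex hα hr hγ hpos) (W u.toNNReal).2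
  have hd : ∀ u ∈ Ici (0 : ℝ), HasDerivWithinAt (fun s : ℝ => (W s.toNNReal : Fin A → ℝ))
      ((1 + (u.toNNReal : ℝ))⁻¹ • field α β r γ (W u.toNNReal)) (Ici 0) u := by
    intro u hu
    have := h.2 u.toNNReal
    rwa [Real.coe_toNNReal u hu] at this ⊢
  have := (convex_Ici (0 : ℝ)).norm_image_sub_le_of_norm_hasDerivWithin_le hd hb
    (x := (t : ℝ)) (y := (s : ℝ)) t.2 s.2
  rw [Real.toNNReal_coe, Real.toNNReal_coe, one_mul, ← dist_eq_norm, ← dist_eq_norm] at this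
  exact this

end WealthModel

/-! ### Finite supports and one-step expectations of the wealth process. -/

/-- Functions of a measurable map that takes finitely many values a.s. are simple a.s. -/
theorem comp_ae_eq_sum_of_ae_mem_finset {Ω E : Type*} [MeasurableSpace Ω] {P : Measure Ω}
    {X : Ω → E} {S : Finset E} (hS : ∀ᵐ ω ∂P, X ω ∈ S) (g : E → ℝ) :
    (fun ω => g (X ω)) =ᵐ[P]
      fun ω => ∑ y ∈ S, g y * (X ⁻¹' {y}).indicator (fun _ => (1 : ℝ)) ω := by
  classical
  filter_upwards [hS] with ω hω
  simp [indicator, hω]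

theorem integrable_comp_of_ae_mem_finset {Ω E : Type*} [MeasurableSpace Ω] [MeasurableSpace E]
    [MeasurableSingletonClass E] {P : Measure Ω} [IsFiniteMeasure P]
    {X : Ω → E} (hX : Measurable X) {S : Finset E} (hS : ∀ᵐ ω ∂P, X ω ∈ S) (g : E → ℝ) :
    Integrable (fun ω => g (X ω)) P := by
  refine Integrable.congr ?_ (comp_ae_eq_sum_of_ae_mem_finset hS g).symm
  exact integrable_finsetSum _ fun y _ =>
    ((integrable_const (1 : ℝ)).indicator (hX (measurableSet_singleton y))).const_mul _

namespace WealthModel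

variable {A : ℕ} {α : Fin A → ℝ} {β r : ℝ} {γ χ x₀ : Fin A → ℝ}

theorem increment_mem_stdSimplex (hr : r ∈ Icc (0 : ℝ) 1) (hγ : γ ∈ stdSimplex ℝ (Fin A))
    (i : Fin A) : increment r γ i ∈ stdSimplex ℝ (Fin A) :=
  convex_stdSimplex ℝ (Fin A) (single_mem_stdSimplex ℝ i) hγ (sub_nonneg.2 hr.2) hr.1 (by ring)

theorem sum_prob_mul_increment [NeZero A] (hα : ∀ i, 0 < α i) {x : Fin A → ℝ}
    (hx : ∀ i, 0 < x i) (j : Fin A) :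
    ∑ i, prob α β x i * increment r γ i j = drift α β r γ x j := by
  have h1 : ∀ i, prob α β x i * increment r γ i j
      = (1 - r) * (if j = i then prob α β x i else 0) + prob α β x i * (r * γ j) := by
    intro i
    simp only [increment, Pi.add_apply, Pi.smul_apply, smul_eq_mul, Pi.single_apply]
    split_ifs <;> ring
  rw [Finset.sum_congr rfl fun i _ => h1 i, Finset.sum_add_distrib, ← Finset.mul_sum,
    Finset.sum_ite_eq, ← Finset.sum_mul, sum_prob hα hx]
  simp [drift]

/-- The states that the wealth process started from `x₀` can reach in `n` steps. -/
noncomputable def reachable (r : ℝ) (γ x₀ : Fin A → ℝ) : ℕ → Finset (Fin A → ℝ)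
  | 0 => {x₀}
  | n + 1 => open Classical in
      (reachable r γ x₀ n ×ˢ Finset.univ).image fun q => q.1 + increment r γ q.2

theorem add_increment_mem_reachable {n : ℕ} {x : Fin A → ℝ} (hx : x ∈ reachable r γ x₀ n)
    (i : Fin A) : x + increment r γ i ∈ reachable r γ x₀ (n + 1) := by
  classical
  exact Finset.mem_image.2 ⟨(x, i), by simpa using hx, rfl⟩

theorem le_and_sum_of_mem_reachable (hr : r ∈ Icc (0 : ℝ) 1) (hγ : γ ∈ stdSimplex ℝ (Fin A))
    {n : ℕ} : ∀ {x : Fin A → ℝ}, x ∈ reachable r γ x₀ n →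
      (∀ i, x₀ i ≤ x i) ∧ ∑ i, x i = ∑ i, x₀ i + n := by
  classical
  induction n with
  | zero =>
    intro x hx
    rw [reachable, Finset.mem_singleton] at hx
    simp [hx]
  | succ n ih =>
    intro x hx
    obtain ⟨⟨y, i⟩, hy, rfl⟩ := Finset.mem_image.1 hx
    obtain ⟨h1, h2⟩ := ih (Finset.mem_product.1 hy).1
    have hv := increment_mem_stdSimplex hr hγ i
    refine ⟨fun j => (h1 j).trans (le_add_of_nonneg_right (hv.1 j)), ?_⟩
    simp only [Pi.add_apply, Finset.sum_add_distrib, hv.2]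
    push_cast
    linarith

namespace IsWealthProcess

variable {Ω : Type*} [MeasurableSpace Ω] {P : Measure Ω} [IsProbabilityMeasure P]
  {X : ℕ → Ω → Fin A → ℝ}

theorem integrable_indicator (h : IsWealthProcess α β r γ x₀ P X) (n : ℕ) {B : Set (Fin A → ℝ)}
    (hB : MeasurableSet B) : Integrable ((X n ⁻¹' B).indicator (fun _ => (1 : ℝ))) P :=
  (integrable_const (1 : ℝ)).indicator (h.measurable n hB)

/-- If on an event of the past no step leads into `B`, then the process does not enter `B`. -/
theorem ae_notMem (h : IsWealthProcess α β r γ x₀ P X) {n : ℕ} {S B : Set (Fin A → ℝ)}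
    (hS : MeasurableSet S) (hB : MeasurableSet B)
    (hSB : ∀ᵐ ω ∂P, X n ω ∈ S → ∀ i, X n ω + increment r γ i ∉ B) :
    ∀ᵐ ω ∂P, X n ω ∈ S → X (n + 1) ω ∉ B := by
  have hm := (Filtration.natural X (fun m => (h.measurable m).stronglyMeasurable)).le n
  have hs : MeasurableSet[Filtration.natural X
      (fun m => (h.measurable m).stronglyMeasurable) n] (X n ⁻¹' S) :=
    le_iSup₂_of_le (f := fun j (_ : j ≤ n) => MeasurableSpace.comap (X j) MeasurableSpace.pi)
      n le_rfl le_rfl _ ⟨S, hS, rfl⟩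
  -- The conditional probability of entering `B` vanishes on the past event; integrating it there
  -- shows that the joint event is null.
  have h1 := setIntegral_condExp hm (h.integrable_indicator (n + 1) hB) hs
  have h2 : ∫ ω in X n ⁻¹' S, (P[(X (n + 1) ⁻¹' B).indicator (fun _ => (1 : ℝ)) |
      Filtration.natural X (fun m => (h.measurable m).stronglyMeasurable) n]) ω ∂P = 0 := by
    rw [← integral_zero Ω ℝ (μ := P.restrict (X n ⁻¹' S))]
    refine setIntegral_congr_ae (hm _ hs) ?_
    filter_upwards [h.transition n B hB, hSB] with ω h3 h4 h5
    rw [h3]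
    exact Finset.sum_eq_zero fun i _ => by simp [h4 h5 i]
  rw [h2, eq_comm, integral_eq_zero_iff_of_nonneg
    (fun ω => indicator_nonneg (fun _ _ => zero_le_one) ω)
    (h.integrable_indicator (n + 1) hB).integrableOn] at h1
  filter_upwards [(ae_restrict_iff' (hm _ hs)).1 h1] with ω h3 h4 h5
  have := h3 h4
  rw [indicator_of_mem (show ω ∈ X (n + 1) ⁻¹' B from h5)] at this
  simp at this

theorem ae_mem_reachable (h : IsWealthProcess α β r γ x₀ P X) (n : ℕ) :
    ∀ᵐ ω ∂P, X n ω ∈ reachable r γ x₀ n := by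
  induction n with
  | zero => filter_upwards [h.initial] with ω hω; simp [reachable, hω]
  | succ n ih =>
    have := h.ae_notMem (n := n) MeasurableSet.univ
      (B := {x | x ∉ reachable r γ x₀ (n + 1)}) (Finset.measurableSet _).compl
      (by filter_upwards [ih] with ω hω _ i using not_not.2 (add_increment_mem_reachable hω i))
    filter_upwards [this] with ω hω
    exact not_not.1 (hω (mem_univ _))

theorem ae_exists_increment (h : IsWealthProcess α β r γ x₀ P X) (n : ℕ) :
    ∀ᵐ ω ∂P, ∃ i, X (n + 1) ω = X n ω + increment r γ i := by
  -- The forbidden set depends on the current state, so each of the finitely many reachable states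
  -- is treated separately.
  have : ∀ x ∈ reachable r γ x₀ n, ∀ᵐ ω ∂P, X n ω ∈ ({x} : Set (Fin A → ℝ)) →
      X (n + 1) ω ∉ (range fun i => x + increment r γ i)ᶜ := fun x _ =>
    h.ae_notMem (measurableSet_singleton x) (finite_range _).measurableSet.compl
      (ae_of_all _ fun ω hω i => by
        rw [mem_singleton_iff.1 hω]
        exact not_not.2 ⟨i, rfl⟩)
  filter_upwards [h.ae_mem_reachable n, (Finset.eventually_all _).2 this] with ω h1 h2
  obtain ⟨i, hi⟩ := not_not.1 (h2 _ h1 rfl)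
  exact ⟨i, hi.symm⟩

theorem integrable_comp (h : IsWealthProcess α β r γ x₀ P X) (n : ℕ) (g : (Fin A → ℝ) → ℝ) :
    Integrable (fun ω => g (X n ω)) P :=
  integrable_comp_of_ae_mem_finset (h.measurable n) (h.ae_mem_reachable n) g

/-- The transition law is given on events only. As `X (n + 1)` has finite support almost surely, `g`
becomes a finite combination of indicators of points, with no regularity needed. -/
theorem integral_comp_succ (h : IsWealthProcess α β r γ x₀ P X) (n : ℕ)
    (g : (Fin A → ℝ) → ℝ) :
    ∫ ω, g (X (n + 1) ω) ∂P = ∫ ω, ∑ i, prob α β (X n ω) i * g (X n ω + increment r γ i) ∂P := by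
  have hm := (Filtration.natural X (fun m => (h.measurable m).stronglyMeasurable)).le n
  have h1 : ∀ y, ∫ ω, (X (n + 1) ⁻¹' {y}).indicator (fun _ => (1 : ℝ)) ω ∂P =
      ∫ ω, ∑ i, prob α β (X n ω) i *
        ({y} : Set (Fin A → ℝ)).indicator (fun _ => (1 : ℝ)) (X n ω + increment r γ i) ∂P := by
    intro y
    rw [← integral_condExp hm]
    exact integral_congr_ae (h.transition n {y} (measurableSet_singleton y))
  rw [integral_congr_ae (comp_ae_eq_sum_of_ae_mem_finset (h.ae_mem_reachable (n + 1)) g),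
    integral_finsetSum _ fun y _ =>
      (h.integrable_indicator (n + 1) (measurableSet_singleton y)).const_mul _]
  simp_rw [integral_const_mul, h1, ← integral_const_mul]
  rw [← integral_finsetSum _ fun y _ => (h.integrable_comp n (fun x => ∑ i, prob α β x i *
        ({y} : Set (Fin A → ℝ)).indicator (fun _ => (1 : ℝ)) (x + increment r γ i))).const_mul _]
  refine integral_congr_ae ?_
  filter_upwards [h.ae_mem_reachable n] with ω hω
  simp_rw [Finset.mul_sum]
  rw [Finset.sum_comm]
  refine Finset.sum_congr rfl fun i _ => ?_
  rw [Finset.sum_eq_single_of_mem _ (add_increment_mem_reachable hω i)]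
  · simp [mul_comm]
  · intro y _ hy
    simp [indicator_of_notMem (s := {y}) (a := X n ω + increment r γ i) hy.symm]

end IsWealthProcess

/-! ### Mean square distance between the wealth process and the flow. -/

/-- One step of the second moment recursion, for a vector `d + w i` with `i` chosen with
probability `p i`. -/
theorem sum_mul_sum_sq_le {p : Fin A → ℝ} (hp0 : ∀ i, 0 ≤ p i) (hp1 : ∑ i, p i = 1)
    {d : Fin A → ℝ} {w : Fin A → Fin A → ℝ} {L N : ℝ} (hL : 0 ≤ L) (hN : 1 ≤ N)
    (hw : ∀ i j, |w i j| ≤ 2 / N) (hm : ∀ j, |∑ i, p i * w i j| ≤ L / N * ‖d‖ + L / N ^ 2) :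
    ∑ i, p i * ∑ j, (d j + w i j) ^ 2 ≤
      (1 + A * (4 * L + 4) / N) * ∑ j, d j ^ 2 + A * (4 * L + 4) / N ^ 2 := by
  have hN0 : 0 < N := by linarith
  set S := ∑ j, d j ^ 2 with hS
  have hdS : ∀ j, d j ^ 2 ≤ S := fun j =>
    Finset.single_le_sum (f := fun j => d j ^ 2) (fun j _ => sq_nonneg _) (Finset.mem_univ j)
  have hS0 : 0 ≤ S := Finset.sum_nonneg fun j _ => sq_nonneg _
  have hnd : ‖d‖ ^ 2 ≤ S := by
    have : ‖d‖ ≤ √S := (pi_norm_le_iff_of_nonneg (Real.sqrt_nonneg _)).2 fun j =>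
      Real.abs_le_sqrt (hdS j)
    calc ‖d‖ ^ 2 ≤ √S ^ 2 := by gcongr
      _ = S := Real.sq_sqrt hS0
  have hj : ∀ j, ∑ i, p i * (d j + w i j) ^ 2 ≤
      d j ^ 2 + ((4 * L + 4) / N * S + (4 * L + 4) / N ^ 2) := by
    intro j
    have e : ∑ i, p i * (d j + w i j) ^ 2
        = d j ^ 2 + 2 * d j * (∑ i, p i * w i j) + ∑ i, p i * w i j ^ 2 := by
      have : ∀ i, p i * (d j + w i j) ^ 2
          = p i * d j ^ 2 + 2 * d j * (p i * w i j) + p i * w i j ^ 2 := fun i => by ring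
      simp_rw [this, Finset.sum_add_distrib, ← Finset.mul_sum, ← Finset.sum_mul, hp1, one_mul]
    have hsq : ∑ i, p i * w i j ^ 2 ≤ 4 / N ^ 2 := by
      calc ∑ i, p i * w i j ^ 2 ≤ ∑ i, p i * (2 / N) ^ 2 :=
            Finset.sum_le_sum fun i _ => mul_le_mul_of_nonneg_left
              (sq_le_sq' (abs_le.1 (hw i j)).1 (abs_le.1 (hw i j)).2) (hp0 i)
        _ = 4 / N ^ 2 := by rw [← Finset.sum_mul, hp1, one_mul, div_pow]; norm_num
    have hcross : 2 * d j * (∑ i, p i * w i j) ≤ 2 * ‖d‖ * (L / N * ‖d‖ + L / N ^ 2) := by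
      refine (le_abs_self _).trans ?_
      rw [abs_mul, abs_mul, abs_two]
      gcongr
      · exact norm_le_pi_norm d j
      · exact hm j
    have hq : 2 * ‖d‖ * (L / N * ‖d‖ + L / N ^ 2) ≤ 3 * L / N * S + L / N ^ 2 := by
      -- The part of the cross term linear in `‖d‖` is split so that it costs a multiple of `‖d‖ ^ 2
      -- / N` plus a constant of order `1 / N ^ 2`, as Gronwall requires.
      have h1 : 2 * ‖d‖ * (1 / N) ≤ ‖d‖ ^ 2 + (1 / N) ^ 2 := two_mul_le_add_sq _ _
      have h2 : L / N * (2 * ‖d‖ * (1 / N)) ≤ L / N * (S + (1 / N) ^ 2) := by gcongr; linarith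
      have h3 : L / N * ‖d‖ ^ 2 ≤ L / N * S := by gcongr
      have h4 : L / N * (1 / N) ^ 2 ≤ L / N ^ 2 := by
        have : L / N * (1 / N) ^ 2 = L / N ^ 2 * (1 / N) := by field_simp
        rw [this]
        exact mul_le_of_le_one_right (by positivity) (by rwa [div_le_one hN0])
      have h5 : 2 * ‖d‖ * (L / N * ‖d‖ + L / N ^ 2)
          = 2 * (L / N * ‖d‖ ^ 2) + L / N * (2 * ‖d‖ * (1 / N)) := by
        field_simp
      have h6 : 3 * L / N * S = 3 * (L / N * S) := by ring
      rw [h5, h6]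
      linarith
    have h7 : 3 * L / N * S ≤ (4 * L + 4) / N * S := by gcongr; linarith
    have h8 : L / N ^ 2 + 4 / N ^ 2 ≤ (4 * L + 4) / N ^ 2 := by
      rw [← add_div]; gcongr; linarith
    rw [e]
    linarith
  simp_rw [Finset.mul_sum]
  rw [Finset.sum_comm]
  refine (Finset.sum_le_sum fun j _ => hj j).trans_eq ?_
  rw [Finset.sum_add_distrib, Finset.sum_const, Finset.card_univ, Fintype.card_fin, nsmul_eq_mul]
  ring

/-- A discrete Gronwall inequality. -/
theorem le_mul_exp_of_le_succ {e : ℕ → ℝ} {a b : ℝ} (ha : 0 ≤ a) (hb : 0 ≤ b) (h0 : e 0 ≤ 0)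
    (h : ∀ n, e (n + 1) ≤ (1 + a) * e n + b) (n : ℕ) : e n ≤ b * n * Real.exp (a * n) := by
  induction n with
  | zero => simpa using h0
  | succ n ih =>
    have h1 : (1 + a) * e n ≤ Real.exp a * (b * n * Real.exp (a * n)) := by
      calc (1 + a) * e n ≤ (1 + a) * (b * n * Real.exp (a * n)) := by gcongr
        _ ≤ _ := by gcongr; rw [add_comm]; exact Real.add_one_le_exp a
    have h2 : b ≤ b * Real.exp (a * (n + 1)) :=
      le_mul_of_one_le_right hb (Real.one_le_exp (by positivity))
    calc e (n + 1) ≤ Real.exp a * (b * n * Real.exp (a * n)) + b * Real.exp (a * (n + 1)) :=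
          (h n).trans (add_le_add h1 h2)
      _ = _ := by
        push_cast
        rw [mul_add, mul_one, Real.exp_add]
        ring

/-- The error increment has size at most `2 / N`, contributing `O(1 / N ^ 2)` in square. Its
conditional mean is the drift difference over `N`, controlled by the current error, minus the Euler
error of the flow. -/
theorem IsWealthProcess.integral_sum_sq_le [NeZero A] {Ω : Type*} [MeasurableSpace Ω]
    {P : Measure Ω} [IsProbabilityMeasure P] {X : ℕ → Ω → Fin A → ℝ} {N c : ℝ} (hN : 1 ≤ N)
    (h : IsWealthProcess α β r γ (N • χ) P X)
    (hα : ∀ i, 0 < α i) (hr : r ∈ Icc (0 : ℝ) 1) (hγ : γ ∈ stdSimplex ℝ (Fin A)) (hc : 0 < c)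
    (hcχ : ∀ i, c ≤ χ i) {Y : ℝ → Fin A → ℝ} (hY : IsFlow α β r γ χ Y) (n : ℕ) :
    ∫ ω, ∑ j, ((N⁻¹ • X n ω - Y (n / N)) j) ^ 2 ∂P ≤
      A * (4 * (4 * |β| / c) + 4) / N ^ 2 * n
        * Real.exp (A * (4 * (4 * |β| / c) + 4) / N * n) := by
  have hN0 : 0 < N := by linarith
  have hχ : ∀ i, 0 < χ i := fun i => hc.trans_le (hcχ i)
  refine le_mul_exp_of_le_succ (by positivity) (by positivity)
    (e := fun n => ∫ ω, ∑ j, ((N⁻¹ • X n ω - Y (n / N)) j) ^ 2 ∂P) ?_ (fun n => ?_) n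
  · refine le_of_eq (integral_eq_zero_of_ae ?_)
    filter_upwards [h.initial] with ω hω
    simp [hω, hY.zero, smul_smul, inv_mul_cancel₀ hN0.ne']
  · have hint : ∀ g : (Fin A → ℝ) → ℝ, Integrable (fun ω => g (X n ω)) P := h.integrable_comp n
    rw [h.integral_comp_succ n (fun x => ∑ j, ((N⁻¹ • x - Y ((n + 1 : ℕ) / N)) j) ^ 2),
      ← integral_const_mul]
    have e : ∫ ω, (1 + A * (4 * (4 * |β| / c) + 4) / N) *
          ∑ j, ((N⁻¹ • X n ω - Y (n / N)) j) ^ 2 ∂P + A * (4 * (4 * |β| / c) + 4) / N ^ 2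
        = ∫ ω, ((1 + A * (4 * (4 * |β| / c) + 4) / N) *
          ∑ j, ((N⁻¹ • X n ω - Y (n / N)) j) ^ 2 + A * (4 * (4 * |β| / c) + 4) / N ^ 2) ∂P := by
      rw [integral_add ((hint fun x => ∑ j, ((N⁻¹ • x - Y (n / N)) j) ^ 2).const_mul _)
        (integrable_const _)]
      simp
    rw [e]
    refine integral_mono_ae
      (hint fun x => ∑ i, prob α β x i *
        ∑ j, ((N⁻¹ • (x + increment r γ i) - Y ((n + 1 : ℕ) / N)) j) ^ 2)
      (hint fun x => (1 + A * (4 * (4 * |β| / c) + 4) / N) *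
          ∑ j, ((N⁻¹ • x - Y (n / N)) j) ^ 2 + A * (4 * (4 * |β| / c) + 4) / N ^ 2) ?_
    filter_upwards [h.ae_mem_reachable n] with ω hω
    set x := X n ω
    have hge := (le_and_sum_of_mem_reachable hr hγ hω).1
    have hx : ∀ i, 0 < x i := fun i => (mul_pos hN0 (hχ i)).trans_le (hge i)
    have ht : (0 : ℝ) ≤ n / N := by positivity
    have hNi : (0 : ℝ) ≤ N⁻¹ := by positivity
    have hsucc : ((n + 1 : ℕ) : ℝ) / N = n / N + N⁻¹ := by push_cast; field_simp
    set ΔY := Y (n / N + N⁻¹) - Y (n / N) with hΔ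
    have hΔ1 : ‖ΔY‖ ≤ N⁻¹ := hY.norm_add_sub_le hα hr hγ hχ ht hNi
    have hΔ2 : ‖ΔY - N⁻¹ • drift α β r γ (Y (n / N))‖ ≤ 4 * |β| / c * N⁻¹ ^ 2 :=
      hY.norm_add_sub_sub_le hα hr hγ hc hcχ ht hNi
    have hdr : ‖drift α β r γ x - drift α β r γ (Y (n / N))‖
        ≤ 4 * |β| / c * ‖N⁻¹ • x - Y (n / N)‖ := by
      rw [← drift_smul (inv_pos.2 hN0) fun i => (hx i).le]
      refine norm_drift_sub_le hα hr hc (fun i => (hcχ i).trans ?_)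
        (fun i => (hcχ i).trans (hY.le _ ht i))
      rw [Pi.smul_apply, smul_eq_mul, ← div_eq_inv_mul, le_div_iff₀ hN0, mul_comm]
      exact hge i
    have key := sum_mul_sum_sq_le (p := prob α β x) (d := N⁻¹ • x - Y (n / N))
      (w := fun i => N⁻¹ • increment r γ i - ΔY) (prob_nonneg hα fun i => (hx i).le)
      (sum_prob hα hx) (L := 4 * |β| / c) (by positivity) hN
      (fun i j => ?_) (fun j => ?_)
    · refine le_trans (le_of_eq ?_) key
      refine Finset.sum_congr rfl fun i _ => ?_
      congr 1
      refine Finset.sum_congr rfl fun j _ => ?_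
      congr 1
      rw [hsucc, hΔ]
      simp only [Pi.sub_apply, Pi.add_apply, Pi.smul_apply, smul_eq_mul]
      ring
    · refine (norm_le_pi_norm (N⁻¹ • increment r γ i - ΔY) j).trans
        ((norm_sub_le _ _).trans ?_)
      rw [norm_smul, Real.norm_of_nonneg hNi]
      have := norm_le_one_of_mem_stdSimplex (increment_mem_stdSimplex hr hγ i)
      have h2 : N⁻¹ * ‖increment r γ i‖ ≤ N⁻¹ * 1 := by gcongr
      rw [div_eq_mul_inv]
      linarith
    · have e1 : ∑ i, prob α β x i * (N⁻¹ • increment r γ i - ΔY) j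
          = (N⁻¹ • (drift α β r γ x - drift α β r γ (Y (n / N)))
            - (ΔY - N⁻¹ • drift α β r γ (Y (n / N)))) j := by
        have : ∀ i, prob α β x i * (N⁻¹ • increment r γ i - ΔY) j
            = N⁻¹ * (prob α β x i * increment r γ i j) - prob α β x i * ΔY j := fun i => by
          simp only [Pi.sub_apply, Pi.smul_apply, smul_eq_mul]; ring
        simp_rw [this]
        rw [Finset.sum_sub_distrib, ← Finset.mul_sum, ← Finset.sum_mul, sum_prob hα hx,
          sum_prob_mul_increment hα hx]
        simp only [Pi.sub_apply, Pi.smul_apply, smul_eq_mul]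
        ring
      rw [e1, ← Real.norm_eq_abs]
      refine (norm_le_pi_norm _ j).trans ((norm_sub_le _ _).trans (add_le_add ?_ ?_))
      · rw [norm_smul, Real.norm_of_nonneg hNi]
        calc _ ≤ N⁻¹ * (4 * |β| / c * ‖N⁻¹ • x - Y (n / N)‖) := by gcongr
          _ = _ := by ring
      · exact hΔ2.trans_eq (by ring)

end WealthModel

/-! ### Deterministic limits on the Skorokhod space. -/

namespace SkorokhodSpace

/-- A step path on `[0, T]` depends only on finitely many terms of the sequence. -/
theorem continuous_stepPath {E : Type*} [PseudoMetricSpace E] (N : ℝ) :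
    Continuous (stepPath N : (ℕ → E) → SkorokhodSpace E) := by
  refine ⟨fun s hs => isOpen_iff_mem_nhds.2 fun c hc => ?_⟩
  obtain ⟨T, ε, hε, h⟩ := hs _ hc
  have hfin : ∀ᶠ c' : ℕ → E in 𝓝 c, ∀ n ∈ Finset.range (⌊N * T⌋₊ + 1), dist (c' n) (c n) ≤ ε := by
    refine (Finset.eventually_all _).2 fun n _ => ?_
    have h1 : Tendsto (fun c' : ℕ → E => c' n) (𝓝 c) (𝓝 (c n)) := (continuous_apply n).tendsto c
    exact (h1.eventually (Metric.ball_mem_nhds _ hε)).mono fun _ h => le_of_lt h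
  filter_upwards [hfin] with c' hc'
  refine h ⟨OrderIso.refl _, fun t ht => ⟨by simpa using hε.le, hc' _ ?_⟩⟩
  rw [Finset.mem_range, Nat.lt_succ_iff]
  rcases le_or_gt N 0 with hN | hN
  · rw [Nat.floor_of_nonpos (mul_nonpos_of_nonpos_of_nonneg hN t.coe_nonneg)]
    exact Nat.zero_le _
  · exact Nat.floor_mono (mul_le_mul_of_nonneg_left (NNReal.coe_le_coe.2 ht) hN.le)

/-- Locally uniform convergence in probability to a deterministic path implies convergence in
distribution on the Skorokhod space. -/
theorem tendstoInDistribution_of_tendsto_measure {E : Type*} [PseudoMetricSpace E]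
    {Ω : ℕ → Type*} [∀ k, MeasurableSpace (Ω k)] {P : ∀ k, Measure (Ω k)}
    [∀ k, IsProbabilityMeasure (P k)] {X : ∀ k, Ω k → SkorokhodSpace E}
    (hX : ∀ k, AEMeasurable (X k) (P k)) {Z : SkorokhodSpace E}
    (h : ∀ (T : ℝ≥0) (ε : ℝ), 0 < ε →
      Tendsto (fun k => P k {ω | ¬ ∀ t ≤ T, dist (X k ω t) (Z t) ≤ ε}) atTop (𝓝 0)) :
    TendstoInDistribution X atTop (fun _ : Unit => Z) P (Measure.dirac ()) := by
  -- By the portmanteau criterion only open `G` matter. If `Z ∈ G`, a basic neighbourhood of `Z`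
  -- lies in `G`, and the identity time change suffices; otherwise the Dirac mass of `G` is zero.
  refine ⟨hX, aemeasurable_const, tendsto_of_forall_isOpen_le_liminf' fun G hG => ?_⟩
  simp only [ProbabilityMeasure.coe_mk]
  rw [Measure.map_apply measurable_const hG.measurableSet]
  by_cases hZ : Z ∈ G
  · obtain ⟨T, ε, hε, hsub⟩ := hG Z hZ
    have hlow : ∀ k, 1 - P k {ω | ¬ ∀ t ≤ T, dist (X k ω t) (Z t) ≤ ε} ≤ (P k).map (X k) G := by
      intro k
      rw [Measure.map_apply_of_aemeasurable (hX k) hG.measurableSet, tsub_le_iff_right,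
        ← measure_univ (μ := P k)]
      refine (measure_mono fun ω _ => ?_).trans (measure_union_le _ _)
      by_cases hω : ∀ t ≤ T, dist (X k ω t) (Z t) ≤ ε
      · exact Or.inl (hsub ⟨OrderIso.refl _, fun t ht => ⟨by simpa using hε.le, hω t ht⟩⟩)
      · exact Or.inr hω
    have hlim : Tendsto (fun k => (1 : ENNReal) - P k {ω | ¬ ∀ t ≤ T, dist (X k ω t) (Z t) ≤ ε})
        atTop (𝓝 1) := by
      simpa using ENNReal.Tendsto.sub (tendsto_const_nhds (x := (1 : ENNReal))) (h T ε hε)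
        (Or.inl ENNReal.one_ne_top)
    refine prob_le_one.trans ?_
    rw [← hlim.liminf_eq]
    exact liminf_le_liminf (Eventually.of_forall hlow)
  · simp [preimage, hZ]

end SkorokhodSpace

/-- If a path with steps at most `1 / N` is close to `Z` on a grid of mesh `1 / K`, then it is
close to `Z` everywhere. -/
theorem dist_floor_le_of_dist_grid_le {E : Type*} [PseudoMetricSpace E] {N ε : ℝ} (hN : 0 < N)
    {K : ℕ} (hK : 0 < K) (hNε : 1 / N ≤ ε / 8) (hKε : 1 / (K : ℝ) ≤ ε / 8) {c : ℕ → E}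
    (hc : ∀ n, dist (c n) (c (n + 1)) ≤ 1 / N) {Z : ℝ≥0 → E}
    (hZ : ∀ s t, dist (Z s) (Z t) ≤ dist s t) {T : ℝ≥0}
    (hgrid : ∀ j ∈ Finset.range (⌊K * T⌋₊ + 1),
      dist (c ⌊N * (j / K : ℝ)⌋₊) (Z (⌊N * (j / K : ℝ)⌋₊ / N).toNNReal) ≤ ε / 4)
    {t : ℝ≥0} (ht : t ≤ T) : dist (c ⌊N * (t : ℝ)⌋₊) (Z t) ≤ ε := by
  have hK0 : (0 : ℝ) < K := by exact_mod_cast hK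
  set j := ⌊(K : ℝ) * t⌋₊ with hj
  have hjT : j ∈ Finset.range (⌊K * T⌋₊ + 1) := by
    rw [Finset.mem_range, Nat.lt_succ_iff]
    refine Nat.le_floor ?_
    have h1 : (j : ℝ) ≤ K * t := Nat.floor_le (by positivity)
    have h2 : (K : ℝ) * t ≤ K * T := by gcongr
    have h3 := h1.trans h2
    exact_mod_cast h3
  have hjt : (j : ℝ) / K ≤ t := by
    rw [div_le_iff₀ hK0, mul_comm]
    exact Nat.floor_le (by positivity)
  have htj : (t : ℝ) ≤ j / K + 1 / K := by
    rw [← add_div, le_div_iff₀ hK0, mul_comm]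
    exact (Nat.lt_floor_add_one _).le
  set m := ⌊N * (j / K : ℝ)⌋₊ with hm
  set n := ⌊N * (t : ℝ)⌋₊ with hn
  have hmn : m ≤ n := Nat.floor_mono (by gcongr)
  have hm1 : (m : ℝ) / N ≤ j / K := by
    rw [div_le_iff₀ hN, mul_comm]
    exact Nat.floor_le (by positivity)
  have hm2 : (j : ℝ) / K ≤ m / N + 1 / N := by
    rw [← add_div, le_div_iff₀ hN, mul_comm]
    exact (Nat.lt_floor_add_one _).le
  have hn1 : (n : ℝ) / N ≤ t := by
    rw [div_le_iff₀ hN, mul_comm]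
    exact Nat.floor_le (by positivity)
  have h1 : dist (c m) (c n) ≤ n / N - m / N := by
    refine (dist_le_Ico_sum_of_dist_le hmn fun {k} _ _ => hc k).trans_eq ?_
    rw [Finset.sum_const, Nat.card_Ico, nsmul_eq_mul, Nat.cast_sub hmn]
    ring
  have h2 : dist (Z (m / N : ℝ).toNNReal) (Z t) ≤ t - m / N := by
    refine (hZ _ _).trans_eq ?_
    rw [NNReal.dist_eq, Real.coe_toNNReal _ (by positivity), abs_sub_comm, abs_of_nonneg]
    linarith
  have h3 := hgrid j hjT
  -- Each of the three distances is at most `ε / 4`: for the outer two, `t - m / N ≤ 1 / K + 1 / N`.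
  have h4 := dist_triangle4 (c n) (c m) (Z (m / N : ℝ).toNNReal) (Z t)
  rw [dist_comm (c n) (c m)] at h4
  linarith

/-! ### From wealth to shares, uniformly on compact time intervals. -/

namespace WealthModel

variable {A : ℕ} {α : Fin A → ℝ} {β r : ℝ} {γ : Fin A → ℝ} {χ₀ : stdSimplex ℝ (Fin A)}
  {Ω : Type*} {X : ℕ → Ω → Fin A → ℝ} {N : ℝ}

theorem measurable_share [MeasurableSpace Ω] (hX : ∀ n, Measurable (X n)) (n : ℕ) :
    Measurable (share χ₀ N X n) := by
  have h1 : Measurable fun ω => (N + n)⁻¹ • X n ω := by fun_prop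
  classical
  exact Measurable.dite (s := {ω | (N + n)⁻¹ • X n ω ∈ stdSimplex ℝ (Fin A)})
    (f := fun ω => (⟨(N + n)⁻¹ • X n ω.1, ω.2⟩ : stdSimplex ℝ (Fin A)))
    (h1.comp measurable_subtype_coe).subtype_mk measurable_const
    (h1 (isClosed_stdSimplex ℝ (Fin A)).measurableSet)

theorem measurable_rescaledShare [MeasurableSpace Ω] (hX : ∀ n, Measurable (X n)) :
    Measurable (rescaledShare χ₀ N X) :=
  (SkorokhodSpace.continuous_stepPath N).measurable.comp
    (measurable_pi_lambda _ fun n => measurable_share hX n)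

theorem coe_share_of_mem_reachable (hr : r ∈ Icc (0 : ℝ) 1) (hγ : γ ∈ stdSimplex ℝ (Fin A))
    (hN : 0 < N) {n : ℕ} {ω : Ω} (h : X n ω ∈ reachable r γ (N • (χ₀ : Fin A → ℝ)) n) :
    (share χ₀ N X n ω : Fin A → ℝ) = (N + n)⁻¹ • X n ω := by
  have hNn : 0 < N + n := by positivity
  have hmem : (N + n)⁻¹ • X n ω ∈ stdSimplex ℝ (Fin A) := by
    obtain ⟨h1, h2⟩ := le_and_sum_of_mem_reachable hr hγ h
    refine ⟨fun i => mul_nonneg (inv_nonneg.2 hNn.le)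
      ((mul_nonneg hN.le (χ₀.2.1 i)).trans (h1 i)), ?_⟩
    have h3 : ∑ i, (N • (χ₀ : Fin A → ℝ)) i = N := by
      simp only [Pi.smul_apply, smul_eq_mul, ← Finset.mul_sum]
      exact (congrArg (N * ·) χ₀.2.2).trans (mul_one N)
    simp only [Pi.smul_apply, smul_eq_mul]
    rw [← Finset.mul_sum, h2, h3, inv_mul_cancel₀ hNn.ne']
  rw [share, dif_pos hmem]
  rfl

theorem dist_share_succ_le (hr : r ∈ Icc (0 : ℝ) 1) (hγ : γ ∈ stdSimplex ℝ (Fin A))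
    (hN : 0 < N) {n : ℕ} {ω : Ω} (h : X n ω ∈ reachable r γ (N • (χ₀ : Fin A → ℝ)) n)
    {i : Fin A} (hi : X (n + 1) ω = X n ω + increment r γ i) :
    dist (share χ₀ N X n ω) (share χ₀ N X (n + 1) ω) ≤ 1 / N := by
  have h' : X (n + 1) ω ∈ reachable r γ (N • (χ₀ : Fin A → ℝ)) (n + 1) := by
    rw [hi]; exact add_increment_mem_reachable h i
  have hNn : 0 < N + n := by positivity
  have hNn' : 0 < N + (n + 1 : ℕ) := by positivity
  have hs := coe_share_of_mem_reachable hr hγ hN h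
  -- Total wealth grows by one per step, so the new share is a convex combination of the old share
  -- and the increment, with weight `1 / (N + n + 1)` on the latter.
  have e : (share χ₀ N X (n + 1) ω : Fin A → ℝ) - share χ₀ N X n ω
      = (N + (n + 1 : ℕ))⁻¹ • (increment r γ i - (share χ₀ N X n ω : Fin A → ℝ)) := by
    rw [hs, coe_share_of_mem_reachable hr hγ hN h', hi]
    ext j
    simp only [Pi.add_apply, Pi.smul_apply, Pi.sub_apply, smul_eq_mul]
    push_cast at hNn' ⊢
    field_simp
    ring
  rw [dist_comm]
  change ‖(share χ₀ N X (n + 1) ω : Fin A → ℝ) - share χ₀ N X n ω‖ ≤ 1 / N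
  rw [e, norm_smul, norm_inv, Real.norm_of_nonneg hNn'.le]
  have h1 : ‖increment r γ i - (share χ₀ N X n ω : Fin A → ℝ)‖ ≤ 1 :=
    norm_sub_le_one_of_mem_stdSimplex (increment_mem_stdSimplex hr hγ i) (share χ₀ N X n ω).2
  refine (mul_le_of_le_one_right (by positivity) h1).trans ?_
  rw [one_div]
  gcongr
  exact le_add_of_nonneg_right (Nat.cast_nonneg _)

theorem dist_share_le (hr : r ∈ Icc (0 : ℝ) 1) (hγ : γ ∈ stdSimplex ℝ (Fin A))
    (hN : 0 < N) {Y : ℝ → Fin A → ℝ} {Z : ℝ≥0 → stdSimplex ℝ (Fin A)}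
    (hZ : ∀ t : ℝ≥0, (Z t : Fin A → ℝ) = (1 + (t : ℝ))⁻¹ • Y t) {n : ℕ} {ω : Ω}
    (h : X n ω ∈ reachable r γ (N • (χ₀ : Fin A → ℝ)) n) :
    dist (share χ₀ N X n ω) (Z (n / N).toNNReal) ≤ ‖N⁻¹ • X n ω - Y (n / N)‖ := by
  have hnN : (0 : ℝ) ≤ n / N := by positivity
  have e : (share χ₀ N X n ω : Fin A → ℝ) - Z (n / N).toNNReal
      = (1 + n / N)⁻¹ • (N⁻¹ • X n ω - Y (n / N)) := by
    rw [hZ, coe_share_of_mem_reachable hr hγ hN h, Real.coe_toNNReal _ hnN, smul_sub, smul_smul,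
      ← mul_inv, add_mul, one_mul, div_mul_cancel₀ _ hN.ne']
  change ‖(share χ₀ N X n ω : Fin A → ℝ) - Z (n / N).toNNReal‖ ≤ _
  rw [e, norm_smul, norm_inv, Real.norm_of_nonneg (by positivity)]
  exact mul_le_of_le_one_left (norm_nonneg _) (inv_le_one_of_one_le₀ (by linarith))

variable [MeasurableSpace Ω] {P : Measure Ω} [IsProbabilityMeasure P]

/-- Chebyshev's inequality for the mean square bound; normalising by `1 + n / N ≥ 1` only shrinks
distances. -/
theorem IsWealthProcess.measureReal_dist_share_le [NeZero A] (hN : 1 ≤ N)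
    (h : IsWealthProcess α β r γ (N • (χ₀ : Fin A → ℝ)) P X)
    (hα : ∀ i, 0 < α i) (hr : r ∈ Icc (0 : ℝ) 1) (hγ : γ ∈ stdSimplex ℝ (Fin A)) {c : ℝ}
    (hc : 0 < c) (hcχ : ∀ i, c ≤ (χ₀ : Fin A → ℝ) i) {Y : ℝ → Fin A → ℝ}
    (hY : IsFlow α β r γ χ₀ Y) {Z : ℝ≥0 → stdSimplex ℝ (Fin A)}
    (hZ : ∀ t : ℝ≥0, (Z t : Fin A → ℝ) = (1 + (t : ℝ))⁻¹ • Y t) {T δ : ℝ} (hT : 0 ≤ T)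
    (hδ : 0 < δ) {n : ℕ} (hn : n / N ≤ T) :
    P.real {ω | δ < dist (share χ₀ N X n ω) (Z (n / N).toNNReal)} ≤
      A * (4 * (4 * |β| / c) + 4) * T * Real.exp (A * (4 * (4 * |β| / c) + 4) * T) / δ ^ 2 / N := by
  have hN0 : 0 < N := by linarith
  set C := A * (4 * (4 * |β| / c) + 4) with hC
  have hC0 : 0 ≤ C := by positivity
  set f : Ω → ℝ := fun ω => ∑ j, ((N⁻¹ • X n ω - Y (n / N)) j) ^ 2 with hf
  have hf0 : ∀ ω, 0 ≤ f ω := fun ω => Finset.sum_nonneg fun j _ => sq_nonneg _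
  have h1 : P.real {ω | δ < dist (share χ₀ N X n ω) (Z (n / N).toNNReal)}
      ≤ P.real {ω | δ ^ 2 ≤ f ω} := by
    refine ENNReal.toReal_mono (measure_ne_top _ _) (measure_mono_ae ?_)
    filter_upwards [h.ae_mem_reachable n] with ω hω hd
    have h2 : δ < ‖N⁻¹ • X n ω - Y (n / N)‖ :=
      lt_of_lt_of_le (show δ < _ from hd) (dist_share_le hr hγ hN0 hZ hω)
    have h3 : ‖N⁻¹ • X n ω - Y (n / N)‖ ≤ √(f ω) :=
      (pi_norm_le_iff_of_nonneg (Real.sqrt_nonneg _)).2 fun j => Real.abs_le_sqrt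
        (Finset.single_le_sum (f := fun j => ((N⁻¹ • X n ω - Y (n / N)) j) ^ 2)
          (fun j _ => sq_nonneg _) (Finset.mem_univ j))
    exact (Real.le_sqrt hδ.le (hf0 ω)).1 (h2.le.trans h3)
  have h2 : δ ^ 2 * P.real {ω | δ ^ 2 ≤ f ω} ≤ ∫ ω, f ω ∂P :=
    mul_meas_ge_le_integral_of_nonneg (ae_of_all _ hf0)
      (h.integrable_comp n fun x => ∑ j, ((N⁻¹ • x - Y (n / N)) j) ^ 2) _
  have h3 : ∫ ω, f ω ∂P ≤ C * T * Real.exp (C * T) / N := by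
    refine (h.integral_sum_sq_le hN hα hr hγ hc hcχ hY n).trans ?_
    have e1 : C / N ^ 2 * n * Real.exp (C / N * n)
        = C * (n / N) * Real.exp (C * (n / N)) / N := by
      rw [div_mul_eq_mul_div C N, ← mul_div_assoc C]
      field_simp
    rw [← hC, e1]
    gcongr
  refine h1.trans ?_
  rw [div_right_comm, le_div_iff₀' (by positivity)]
  exact h2.trans h3

theorem IsWealthProcess.measureReal_not_forall_dist_le [NeZero A] (hN : 1 ≤ N)
    (h : IsWealthProcess α β r γ (N • (χ₀ : Fin A → ℝ)) P X)
    (hα : ∀ i, 0 < α i) (hr : r ∈ Icc (0 : ℝ) 1) (hγ : γ ∈ stdSimplex ℝ (Fin A)) {c : ℝ}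
    (hc : 0 < c) (hcχ : ∀ i, c ≤ (χ₀ : Fin A → ℝ) i) {Y : ℝ → Fin A → ℝ}
    (hY : IsFlow α β r γ χ₀ Y) {Z : ℝ≥0 → stdSimplex ℝ (Fin A)}
    (hZ : ∀ t : ℝ≥0, (Z t : Fin A → ℝ) = (1 + (t : ℝ))⁻¹ • Y t) {T : ℝ≥0} {ε : ℝ}
    (hε : 0 < ε) {K : ℕ} (hK : 0 < K) (hNε : 1 / N ≤ ε / 8) (hKε : 1 / (K : ℝ) ≤ ε / 8) :
    P.real {ω | ¬ ∀ t ≤ T, dist (rescaledShare χ₀ N X ω t) (Z t) ≤ ε} ≤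
      (⌊K * T⌋₊ + 1 : ℕ) * (A * (4 * (4 * |β| / c) + 4) * T *
        Real.exp (A * (4 * (4 * |β| / c) + 4) * T) / (ε / 4) ^ 2 / N) := by
  have hN0 : 0 < N := by linarith
  have hK0 : (0 : ℝ) < K := by exact_mod_cast hK
  have hχ : ∀ i, 0 < (χ₀ : Fin A → ℝ) i := fun i => hc.trans_le (hcχ i)
  have hlip := (hY.isSolution hχ hZ).dist_le hα hr hγ hχ
  have hsub : P.real {ω | ¬ ∀ t ≤ T, dist (rescaledShare χ₀ N X ω t) (Z t) ≤ ε} ≤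
      P.real (⋃ j ∈ Finset.range (⌊K * T⌋₊ + 1), {ω | ε / 4 <
        dist (share χ₀ N X ⌊N * (j / K : ℝ)⌋₊ ω) (Z (⌊N * (j / K : ℝ)⌋₊ / N).toNNReal)}) := by
    refine ENNReal.toReal_mono (measure_ne_top _ _) (measure_mono_ae ?_)
    filter_upwards [ae_all_iff.2 h.ae_mem_reachable, ae_all_iff.2 h.ae_exists_increment]
      with ω h1 h2 hbad
    by_contra hcon
    refine hbad fun t ht => ?_
    refine dist_floor_le_of_dist_grid_le hN0 hK hNε hKε (c := fun n => share χ₀ N X n ω)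
      (fun n => ?_) hlip (fun j hj => not_lt.1 fun hlt => hcon ?_) ht
    · obtain ⟨i, hi⟩ := h2 n
      exact dist_share_succ_le hr hγ hN0 (h1 n) hi
    · exact mem_iUnion₂.2 ⟨j, hj, hlt⟩
  refine hsub.trans ((measureReal_biUnion_finset_le _ _).trans ?_)
  refine (Finset.sum_le_card_nsmul _ _ _ fun j hj => ?_).trans_eq
    (by rw [Finset.card_range, nsmul_eq_mul])
  refine h.measureReal_dist_share_le hN hα hr hγ hc hcχ hY hZ T.coe_nonneg (by positivity) ?_
  have hjT : (j : ℝ) ≤ K * T := by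
    have h1 : (j : ℝ≥0) ≤ K * T := (Nat.le_floor_iff (zero_le)).1
      (Nat.lt_succ_iff.1 (Finset.mem_range.1 hj))
    exact_mod_cast h1
  calc (⌊N * (j / K : ℝ)⌋₊ : ℝ) / N ≤ j / K := by
        rw [div_le_iff₀ hN0, mul_comm]
        exact Nat.floor_le (by positivity)
    _ ≤ T := by rwa [div_le_iff₀ hK0, mul_comm]

end WealthModel

theorem mainTheorem6 {A : ℕ} (hA : 2 ≤ A) (α : Fin A → ℝ) (hα : ∀ i, 0 < α i) (β : ℝ)
    (r : ℝ) (hr : r ∈ Set.Icc (0 : ℝ) 1) (γ : Fin A → ℝ) (hγ : γ ∈ stdSimplex ℝ (Fin A))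
    (χ₀ : stdSimplex ℝ (Fin A))
    (N : ℕ → ℝ) (hN : Tendsto N atTop atTop)
    (hN_ge : ∀ k i, 1 ≤ N k * (χ₀ : Fin A → ℝ) i)
    {Ω : ℕ → Type*} [∀ k, MeasurableSpace (Ω k)]
    (P : ∀ k, Measure (Ω k)) [∀ k, IsProbabilityMeasure (P k)]
    (X : ∀ k, ℕ → Ω k → Fin A → ℝ)
    (hX : ∀ k, WealthModel.IsWealthProcess α β r γ (N k • (χ₀ : Fin A → ℝ)) (P k) (X k)) :
    ∃ Z : SkorokhodSpace (stdSimplex ℝ (Fin A)),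
      WealthModel.IsSolution α β r γ χ₀ Z ∧
      (∀ W : ℝ≥0 → stdSimplex ℝ (Fin A), WealthModel.IsSolution α β r γ χ₀ W → W = Z) ∧
      TendstoInDistribution (fun k => WealthModel.rescaledShare χ₀ (N k) (X k)) atTop
        (fun _ : Unit => Z) P (Measure.dirac ()) := by
  have : NeZero A := ⟨by omega⟩
  have hχ : ∀ i, 0 < (χ₀ : Fin A → ℝ) i := fun i =>
    (χ₀.2.1 i).lt_of_ne fun h0 => by
      have h1 := hN_ge 0 i
      rw [show (χ₀ : Fin A → ℝ) i = 0 from h0.symm, mul_zero] at h1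
      exact absurd h1 (by norm_num)
  obtain ⟨Y, hY⟩ := WealthModel.exists_isFlow hα (β := β) hr hγ hχ
  set Z : ℝ≥0 → stdSimplex ℝ (Fin A) := fun t =>
    ⟨(1 + (t : ℝ))⁻¹ • Y t, hY.inv_smul_mem_stdSimplex hα hr hγ hχ χ₀.2.2 t.2⟩ with hZ
  have hZY : ∀ t, (Z t : Fin A → ℝ) = (1 + (t : ℝ))⁻¹ • Y t := fun t => rfl
  have hsol := hY.isSolution hχ hZY
  have hcont : Continuous Z := (LipschitzWith.of_dist_le_mul (K := 1) fun s t => by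
    simpa using hsol.dist_le hα hr hγ hχ s t).continuous
  refine ⟨⟨Z, fun t => hcont.continuousWithinAt, fun t =>
    ⟨Z t, hcont.continuousWithinAt⟩⟩, hsol, fun W hW => funext fun t => ?_, ?_⟩
  · refine DFunLike.coe_injective ?_
    have h1 := (hW.isFlow hα hr hγ).eqOn hY hα hr hχ t.2
    change (W t : Fin A → ℝ) = (1 + (t : ℝ))⁻¹ • Y t
    rw [NNReal.val_eq_coe] at h1
    rw [← h1, Real.toNNReal_coe, smul_smul, inv_mul_cancel₀ (by positivity), one_smul]
  · refine SkorokhodSpace.tendstoInDistribution_of_tendsto_measure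
      (fun k => (WealthModel.measurable_rescaledShare (hX k).measurable).aemeasurable)
      fun T ε hε => ?_
    obtain ⟨c, hc, hcχ⟩ := WealthModel.exists_pos_le hχ
    -- The mesh depends on `ε` alone, so the number of grid points stays fixed while each
    -- probability is `O(1 / N k)`.
    obtain ⟨K, hK⟩ := exists_nat_one_div_lt (show 0 < ε / 8 by positivity)
    have hKε : 1 / ((K + 1 : ℕ) : ℝ) ≤ ε / 8 := by exact_mod_cast hK.le
    have hreal : Tendsto (fun k => (P k).real {ω | ¬ ∀ t ≤ T,
        dist (WealthModel.rescaledShare χ₀ (N k) (X k) ω t) (Z t) ≤ ε}) atTop (𝓝 0) := by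
      refine squeeze_zero' (Eventually.of_forall fun k => measureReal_nonneg) ?_ ?_
        (g := fun k => (⌊(K + 1 : ℕ) * T⌋₊ + 1 : ℕ) * (A * (4 * (4 * |β| / c) + 4) * T *
          Real.exp (A * (4 * (4 * |β| / c) + 4) * T) / (ε / 4) ^ 2 / N k))
      · filter_upwards [hN.eventually_ge_atTop 1, hN.eventually_ge_atTop (8 / ε)] with k h1 h2
        refine (hX k).measureReal_not_forall_dist_le h1 hα hr hγ hc hcχ hY hZY hε
          (Nat.succ_pos K) ?_ hKε
        rw [div_le_div_iff₀ (by linarith) (by norm_num), one_mul]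
        rwa [div_le_iff₀ hε, mul_comm] at h2
      · simpa using (hN.const_div_atTop _).const_mul ((⌊(K + 1 : ℕ) * T⌋₊ + 1 : ℕ) : ℝ)
    rw [← ENNReal.ofReal_zero]
    refine (ENNReal.tendsto_ofReal hreal).congr fun k => ?_
    exact ofReal_measureReal
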